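/- Let $R$ be a left noetherian ring and let ${}_RU$ be a generalized tilting (Wakamatsu tilting) left $R$-module whose endomorphism ring $S=\mathrm{End}({}_RU)$, acting on $U$ from the right, is right noetherian. That is: $U$ is finitely generated and has a resolution $\cdots\to P_1\to P_0\to U\to 0$ by finitely generated projective modules; $\mathrm{Ext}^i_R(U,U)=0$ for all $i\ge 1$; and there is an exact sequence $0\to R\to U_0\to U_1\to\cdots$, with every $U_i$ a direct summand of a finite direct sum of copies of $U$, that remains exact after applying $\mathrm{Hom}_R(-,U)$. Let $\mathrm{Add}_RU$ be the class of all $R$-modules isomorphic to direct summands of (arbitrary) direct sums of copies of $U$, and let $\mathrm{add\text{-}lim}_RU$ be the class of all $R$-modules isomorphic to direct summands of direct limits of modules each of which is a finite direct sum of copies of $U$. For a class $\mathcal X$ of $R$-modules and an $R$-module $A$, let $\mathcal X\text{-resol.dim}_R(A)$ be the infimum of all $m\ge 0$ for which there is an exact sequence $0\to T_m\to\cdots\to T_1\to T_0\to A\to 0$ with all $T_i\in\mathcal X$, and $\infty$ if there is no such $m$; the $U$-limit dimension is $U\text{-lim.dim}_R(A)=\mathrm{add\text{-}lim}_RU\text{-resol.dim}_R(A)$.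 Write ${}^*A=\mathrm{Hom}_R(U,A)$, a left $S$-module, and let $\mathrm{l.id}$, $\mathrm{l.fd}$, $\mathrm{l.pd}$ denote the injective, flat and projective dimension of left modules (the zero module having dimension $0$). Theorem 2.11. Let $E$ be an injective left $R$-module and suppose that $\mathrm{l.id}_R(U)=n<\infty$. Then the following statements are equivalent: 1. $\mathrm{l.fd}_S({}^*E)<\infty$; 2. $\mathrm{l.pd}_S({}^*E)<\infty$; 3. $U\text{-lim.dim}_R(E)<\infty$; 4. $\mathrm{Add}_RU\text{-resol.dim}_R(E)<\infty$; 5. $\mathrm{l.fd}_S({}^*E)\le n$; 6. $\mathrm{l.pd}_S({}^*E)\le n$; 7. $U\text{-lim.dim}_R(E)\le n$; 8. $\mathrm{Add}_RU\text{-resol.dim}_R(E)\le n$. -/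

import Mathlib

universe u

open CategoryTheory
open scoped TensorProduct

noncomputable section

namespace WakamatsuTilting

/-! ### Exact resolutions by a class of modules -/

/-- There is an infinite exact sequence `⋯ → T₁ → T₀ → A → 0` of left `R`-modules with all `Tᵢ`
in the class `X`. -/
def HasResolution {R : Type u} [Ring R] (X : ModuleCat.{u} R → Prop) (A : ModuleCat.{u} R) : Prop :=
  ∃ (T : ℕ → ModuleCat.{u} R) (d : ∀ i, T (i + 1) →ₗ[R] T i) (ε : T 0 →ₗ[R] A),
    (∀ i, X (T i)) ∧
    Function.Surjective ε ∧ Function.Exact (d 0) ε ∧ ∀ i, Function.Exact (d (i + 1)) (d i)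

/-- There is an exact sequence `0 → Tₘ → ⋯ → T₁ → T₀ → A → 0` of left `R`-modules with `Tᵢ` in the
class `X` for `0 ≤ i ≤ m`. The sequence is continued to the left by zero modules, so exactness at
`Tₘ` says that the leftmost map is injective. -/
def HasResolutionOfLength {R : Type u} [Ring R] (X : ModuleCat.{u} R → Prop) (A : ModuleCat.{u} R)
    (m : ℕ) : Prop :=
  ∃ (T : ℕ → ModuleCat.{u} R) (d : ∀ i, T (i + 1) →ₗ[R] T i) (ε : T 0 →ₗ[R] A),
    (∀ i, i ≤ m → X (T i)) ∧ (∀ i, m < i → Subsingleton (T i)) ∧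
    Function.Surjective ε ∧ Function.Exact (d 0) ε ∧ ∀ i, Function.Exact (d (i + 1)) (d i)

/-- `X-resol.dim_R(A)`: the infimum of the lengths of finite exact resolutions of `A` by modules
in `X`, and `∞` if there is none. -/
def resolDim {R : Type u} [Ring R] (X : ModuleCat.{u} R → Prop) (A : ModuleCat.{u} R) : ℕ∞ :=
  sInf {m : ℕ∞ | ∃ k : ℕ, m = k ∧ HasResolutionOfLength X A k}

/-! ### Injective, projective and flat dimension -/

/-- The injective dimension, with the zero module having dimension `0`. -/
def injDim {R : Type u} [Ring R] (A : ModuleCat.{u} R) : ℕ∞ :=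
  (injectiveDimension A).unbotD 0

/-- The projective dimension, with the zero module having dimension `0`. -/
def projDim {R : Type u} [Ring R] (A : ModuleCat.{u} R) : ℕ∞ :=
  (projectiveDimension A).unbotD 0

/-- The subgroup of `M ⊗_ℤ F` generated by the elements `(m s) ⊗ x - m ⊗ (s x)`, for a right
`S`-module `M` (that is, a left `Sᵐᵒᵖ`-module) and a left `S`-module `F`. -/
def balancedRel (S : Type u) [Ring S] (M F : Type u) [AddCommGroup M] [Module Sᵐᵒᵖ M]
    [AddCommGroup F] [Module S F] : AddSubgroup (M ⊗[ℤ] F) :=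
  AddSubgroup.closure
    {t | ∃ (m : M) (s : S) (x : F), t = (MulOpposite.op s • m) ⊗ₜ[ℤ] x - m ⊗ₜ[ℤ] (s • x)}

/-- The tensor product `M ⊗_S F` over a not necessarily commutative ring `S`. -/
abbrev BalancedTensor (S : Type u) [Ring S] (M F : Type u) [AddCommGroup M] [Module Sᵐᵒᵖ M]
    [AddCommGroup F] [Module S F] : Type u :=
  (M ⊗[ℤ] F) ⧸ balancedRel S M F

theorem balancedRel_le_comap (S : Type u) [Ring S] {M N : Type u} (F : Type u)
    [AddCommGroup M] [Module Sᵐᵒᵖ M] [AddCommGroup N] [Module Sᵐᵒᵖ N]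
    [AddCommGroup F] [Module S F] (f : M →ₗ[Sᵐᵒᵖ] N) :
    balancedRel S M F ≤
      (balancedRel S N F).comap (f.toAddMonoidHom.toIntLinearMap.rTensor F).toAddMonoidHom := by
  refine (AddSubgroup.closure_le _).2 ?_
  rintro _ ⟨m, s, x, rfl⟩
  exact AddSubgroup.subset_closure ⟨f m, s, x, by simp⟩

/-- The homomorphism `f ⊗_S F : M ⊗_S F → N ⊗_S F` induced by `f : M → N`. -/
def balancedMap (S : Type u) [Ring S] {M N : Type u} (F : Type u)
    [AddCommGroup M] [Module Sᵐᵒᵖ M] [AddCommGroup N] [Module Sᵐᵒᵖ N]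
    [AddCommGroup F] [Module S F] (f : M →ₗ[Sᵐᵒᵖ] N) :
    BalancedTensor S M F →+ BalancedTensor S N F :=
  QuotientAddGroup.map _ _ (f.toAddMonoidHom.toIntLinearMap.rTensor F).toAddMonoidHom
    (balancedRel_le_comap S F f)

/-- A left `S`-module `F` is flat if `- ⊗_S F` preserves injectivity of homomorphisms of right
`S`-modules. -/
def IsFlat {S : Type u} [Ring S] (F : ModuleCat.{u} S) : Prop :=
  ∀ (M N : Type u) [AddCommGroup M] [Module Sᵐᵒᵖ M] [AddCommGroup N] [Module Sᵐᵒᵖ N]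
    (f : M →ₗ[Sᵐᵒᵖ] N), Function.Injective f → Function.Injective (balancedMap S F f)

/-- The flat dimension: the shortest length of a resolution by flat modules. -/
def flatDim {S : Type u} [Ring S] (A : ModuleCat.{u} S) : ℕ∞ :=
  resolDim IsFlat A

/-! ### The subcategories `add U`, `Add U` and `add-lim U` -/

/-- `A` is isomorphic to a direct summand of `B`. -/
def IsSummand {R : Type u} [Ring R] (A B : Type u) [AddCommGroup A] [Module R A]
    [AddCommGroup B] [Module R B] : Prop :=
  ∃ (i : A →ₗ[R] B) (p : B →ₗ[R] A), p.comp i = LinearMap.id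

/-- `add U`: direct summands of finite direct sums of copies of `U`. -/
def IsAddFin {R : Type u} [Ring R] (U : ModuleCat.{u} R) (A : ModuleCat.{u} R) : Prop :=
  ∃ k : ℕ, IsSummand (R := R) A (Fin k → U)

/-- `Add U`: direct summands of arbitrary direct sums of copies of `U`. -/
def IsAdd {R : Type u} [Ring R] (U : ModuleCat.{u} R) (A : ModuleCat.{u} R) : Prop :=
  ∃ I : Type u, IsSummand (R := R) A (I →₀ U)

/-- `add-lim U`: direct summands of direct limits, over directed index sets, of finite direct sums
of copies of `U`. -/
def IsAddLim {R : Type u} [Ring R] (U : ModuleCat.{u} R) (A : ModuleCat.{u} R) : Prop :=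
  ∃ (I : Type u) (_ : Preorder I) (_ : DecidableEq I) (_ : Nonempty I) (_ : IsDirectedOrder I)
    (k : I → ℕ) (f : ∀ i j, i ≤ j → (Fin (k i) → U) →ₗ[R] (Fin (k j) → U))
    (_ : DirectedSystem (fun i => Fin (k i) → U) (fun i j h => f i j h)),
    IsSummand (R := R) A (Module.DirectLimit (fun i => Fin (k i) → U) f)

/-- The `U`-limit dimension. -/
def limDim {R : Type u} [Ring R] (U : ModuleCat.{u} R) (A : ModuleCat.{u} R) : ℕ∞ :=
  resolDim (IsAddLim U) A

/-- The `Add U`-resolution dimension. -/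
def addResolDim {R : Type u} [Ring R] (U : ModuleCat.{u} R) (A : ModuleCat.{u} R) : ℕ∞ :=
  resolDim (IsAdd U) A

/-! ### Generalized tilting modules -/

/-- `U` is finitely generated and has a resolution by finitely generated projective modules. -/
def InGenStar {R : Type u} [Ring R] (U : ModuleCat.{u} R) : Prop :=
  Module.Finite R U ∧ HasResolution (fun P => Module.Finite R P ∧ Module.Projective R P) U

/-- `Ext^i_R(U, U) = 0` for all `i ≥ 1`. -/
def IsSelforthogonal {R : Type u} [Ring R] (U : ModuleCat.{u} R) : Prop :=
  ∀ i : ℕ, 1 ≤ i → Subsingleton (Abelian.Ext.{u} U U i)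

/-- A generalized tilting (Wakamatsu tilting) module: a selforthogonal module in `gen^*(R)` with an
exact sequence `0 → R → U₀ → U₁ → ⋯`, all `Uᵢ` in `add U`, that stays exact under `Hom_R(-, U)`. -/
def IsGeneralizedTilting {R : Type u} [Ring R] (U : ModuleCat.{u} R) : Prop :=
  InGenStar U ∧ IsSelforthogonal U ∧
  ∃ (W : ℕ → ModuleCat.{u} R) (η : R →ₗ[R] W 0) (d : ∀ i, W i →ₗ[R] W (i + 1)),
    (∀ i, IsAddFin U (W i)) ∧
    (Function.Injective η ∧ Function.Exact η (d 0) ∧ ∀ i, Function.Exact (d i) (d (i + 1))) ∧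
    (Function.Surjective (fun g : W 0 →ₗ[R] U => g.comp η) ∧
      Function.Exact (fun g : W 1 →ₗ[R] U => g.comp (d 0)) (fun g : W 0 →ₗ[R] U => g.comp η) ∧
      ∀ i, Function.Exact (fun g : W (i + 1 + 1) →ₗ[R] U => g.comp (d (i + 1)))
        (fun g : W (i + 1) →ₗ[R] U => g.comp (d i)))

/-! ### The ring `S` and the functor `Hom_R(U, -)` -/

/-- The endomorphism ring `S` of the left module `U`, acting on `U` from the right. With maps
composed in Mathlib's order this is the opposite of `Module.End R U`; Mathlib's `DomMulAct` is this
opposite ring together with its left action `(s • g)(x) = g (x s)` on `Hom_R(U, A)`. -/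
abbrev EndRing {R : Type u} [Ring R] (U : ModuleCat.{u} R) : Type u :=
  (Module.End R U)ᵈᵐᵃ

/-- `^*A = Hom_R(U, A)` as a left module over `S = End(U)`. -/
def starModule {R : Type u} [Ring R] (U A : ModuleCat.{u} R) : ModuleCat.{u} (EndRing U) :=
  ModuleCat.of (EndRing U) (U →ₗ[R] A)

end WakamatsuTilting

end

/-! The substantial implication runs from finite flat dimension of `Hom_R(U, E)` to an `Add
U`-resolution of `E` of length `n`. Put `X_0 = E` and let `X_{j+1}` be the kernel of the evaluation
map `U^(Hom_R(U, X_j)) → X_j` (`syzygy`). Call `X` coacyclic if `Hom_R(-, X)` is exact on the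
coresolution `0 → R → W_0 → W_1 → ⋯`. The injective module `E` is coacyclic, and this passes to
every `X_j` (`IsCoacyclic.syzygy`); it makes all the evaluation maps surjective.

Under `Hom_R(U, -)` these short exact sequences stay exact with flat middle terms, so `Hom_R(U,
X_j)` is flat for large `j`; this is checked on character modules, where it concerns injective
dimension. If `X` is coacyclic and `Hom_R(U, X)` is flat, every map from a finitely generated module
to `X` factors through a finite power of `U` (`IsCoacyclic.locallyAdd`). Over a noetherian ring such
an `X` inherits from `U` the vanishing of `Ext^i(M, -)` for finitely generated `M` and `i ≥ 1`; so
its injective dimension is at most `n` and `Ext^i(U, X) = 0` for `i ≥ 1`.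

Now let `j ≥ n` and let `X_{j+1}` be of this kind. Dimension shifting reduces the vanishing of
`Ext^1(X_j, X_{j+1})` to that of `Ext^{j+1}(E, X_{j+1})`, which holds. So `X_j` is a summand of a
direct sum of copies of `U`, hence again of this kind, and one descends to `X_n`.

For the other implications, `Hom_R(U, -)` keeps finite resolutions by `add-lim U` exact, and sends
`Add U` to projective and `add-lim U` to flat modules. -/

noncomputable section

namespace WakamatsuTilting

/-! ### Flat modules and character modules -/

section Flat

/-- A map that vanishes on the kernel of `h` extends along `h` if its target satisfies Baer's
criterion. -/
theorem exists_comp_eq_of_baer {R : Type*} [Ring R] {A B Q : Type*} [AddCommGroup A] [Module R A]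
    [AddCommGroup B] [Module R B] [AddCommGroup Q] [Module R Q] (hQ : Module.Baer R Q)
    (h : A →ₗ[R] B) (g : A →ₗ[R] Q) (hg : LinearMap.ker h ≤ LinearMap.ker g) :
    ∃ g' : B →ₗ[R] Q, g'.comp h = g := by
  obtain ⟨g', hg'⟩ := hQ.extension_property ((LinearMap.ker h).liftQ h le_rfl)
    (LinearMap.ker_eq_bot.1 (Submodule.ker_liftQ_eq_bot' _ _ rfl)) ((LinearMap.ker h).liftQ g hg)
  refine ⟨g', LinearMap.ext fun a => ?_⟩
  simpa using LinearMap.congr_fun hg' (Submodule.Quotient.mk a)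

theorem exists_addMonoidHom_comp_eq {A B : Type*} [AddCommGroup A] [AddCommGroup B]
    (h : A →+ B) (g : A →+ AddCircle (1 : ℚ)) (hg : ∀ a, h a = 0 → g a = 0) :
    ∃ g' : B →+ AddCircle (1 : ℚ), ∀ a, g' (h a) = g a := by
  obtain ⟨g', hg'⟩ := exists_comp_eq_of_baer (Module.Baer.of_divisible _)
    h.toIntLinearMap g.toIntLinearMap (fun a ha => hg a ha)
  exact ⟨g'.toAddMonoidHom, fun a => LinearMap.congr_fun hg' a⟩

variable {S : Type u} [Ring S] (F : Type u) [AddCommGroup F] [Module S F]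

/-- The right `S`-module structure on the character module of a left `S`-module. -/
instance characterModuleOp : Module Sᵐᵒᵖ (CharacterModule F) where
  smul c φ := (φ : F →+ AddCircle (1 : ℚ)).comp (DistribSMul.toAddMonoidHom F c.unop)
  one_smul φ := CharacterModule.ext _ fun x => congrArg φ (one_smul S x)
  mul_smul c d φ := CharacterModule.ext _ fun x => congrArg φ (mul_smul d.unop c.unop x)
  smul_zero _ := rfl
  smul_add _ _ _ := rfl
  add_smul c d φ := CharacterModule.ext _ fun x =>
    (congrArg φ (add_smul c.unop d.unop x)).trans (map_add φ _ _)
  zero_smul φ := CharacterModule.ext _ fun x => (congrArg φ (zero_smul S x)).trans (map_zero φ)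

variable {F}

theorem op_smul_character_apply (c : Sᵐᵒᵖ) (φ : CharacterModule F) (x : F) :
    (c • φ) x = φ (c.unop • x) := rfl

variable (S F)

/-- A left `S`-module is equationally flat if every linear relation between elements is a
consequence of relations in `S`. -/
def EqFlat : Prop :=
  ∀ (ι : Type) [Fintype ι] (s : ι → S) (x : ι → F), ∑ i, s i • x i = 0 →
    ∃ (κ : Type) (_ : Fintype κ) (a : ι → κ → S) (y : κ → F),
      (∀ i, x i = ∑ j, a i j • y j) ∧ ∀ j, ∑ i, s i * a i j = 0

variable {S F}

/-- Baer's criterion: an extension of `g : I → F⁺` to the ring is a character `φ` with `φ (s x) =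
g(s)(x)` for `s ∈ I`. It exists once `∑ s z_s = 0` forces `∑ g(s)(z_s) = 0`, and equational flatness
rewrites the latter sum as `∑_j g(∑_i s_i a_ij)(y_j)`. -/
theorem EqFlat.injective_character (hF : EqFlat S F) :
    Module.Injective Sᵐᵒᵖ (CharacterModule F) := by
  refine Module.Baer.injective fun I g => ?_
  let Θ : (I →₀ F) →+ F := Finsupp.liftAddHom fun s =>
    DistribSMul.toAddMonoidHom F (MulOpposite.unop (s : Sᵐᵒᵖ))
  let G : (I →₀ F) →+ AddCircle (1 : ℚ) := Finsupp.liftAddHom fun s => (g s : F →+ _)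
  have hΘG : ∀ z, Θ z = 0 → G z = 0 := by
    intro z hz
    let e := z.support.equivFin.symm
    -- The relation is reindexed by `Fin`, since `EqFlat` takes index types in `Type`. Two copies
    -- are needed because the sums in `F` and in the circle lie in different universes.
    have hsum : ∀ {B : Type u} [AddCommMonoid B] (w : I → B),
        ∑ s ∈ z.support, w s = ∑ i, w (e i) := fun w => by
      rw [← Finset.sum_coe_sort, ← e.sum_comp]
    have hsum' : ∀ {B : Type} [AddCommMonoid B] (w : I → B),
        ∑ s ∈ z.support, w s = ∑ i, w (e i) := fun w => by
      rw [← Finset.sum_coe_sort, ← e.sum_comp]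
    have hz' : ∑ i, (((e i : I) : Sᵐᵒᵖ).unop) • z (e i) = 0 := by
      rw [← hsum fun s => ((s : Sᵐᵒᵖ).unop) • z s]
      exact hz
    obtain ⟨κ, _, a, y, hx, ha⟩ := hF _ _ _ hz'
    have hG : G z = ∑ i, g (e i) (z (e i)) := by
      rw [← hsum' fun s => g s (z s)]
      rfl
    have hj : ∀ j, ∑ i, g (e i) (a i j • y j) = 0 := by
      intro j
      have h0 : ∑ i, MulOpposite.op (a i j) • (e i : I) = 0 := by
        apply Subtype.ext
        apply MulOpposite.unop_injective
        simpa using ha j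
      have h1 : ∑ i, MulOpposite.op (a i j) • g (e i) = 0 := by
        simpa using congrArg g h0
      let ev : CharacterModule F →+ AddCircle (1 : ℚ) :=
        (AddMonoidHom.eval (y j) : (F →+ AddCircle (1 : ℚ)) →+ AddCircle (1 : ℚ))
      have h2 := congrArg ev h1
      rw [map_sum, map_zero] at h2
      exact h2
    rw [hG]
    calc ∑ i, g (e i) (z (e i)) = ∑ i, ∑ j, g (e i) (a i j • y j) := by
          refine Finset.sum_congr rfl fun i _ => ?_
          rw [hx i, map_sum]
      _ = 0 := by rw [Finset.sum_comm]; exact Finset.sum_eq_zero fun j _ => hj j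
  obtain ⟨φ, hφ⟩ := exists_addMonoidHom_comp_eq Θ G hΘG
  refine ⟨LinearMap.toSpanSingleton _ _ (φ : CharacterModule F), fun c hc => ?_⟩
  refine CharacterModule.ext _ fun x => ?_
  have h1 : Θ (Finsupp.single ⟨c, hc⟩ x) = c.unop • x := Finsupp.liftAddHom_apply_single _ _ _
  have h2 : G (Finsupp.single ⟨c, hc⟩ x) = g ⟨c, hc⟩ x := Finsupp.liftAddHom_apply_single _ _ _
  rw [← h2, ← hφ, h1]
  rfl

/-- The conclusion says that `x` is a sum of vectors `t • y` with `∑ s_i t_i = 0`. Otherwise some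
character `χ'` of `F^ι` kills all these vectors but not `x`. Then `t ↦ χ'(t • -)` vanishes on the
kernel of `t ↦ ∑ s_i t_i`, so by injectivity it extends along this map to `γ'`, and `χ'(x) = γ'(1)(∑
s_i x_i) = 0`. -/
theorem eqFlat_of_injective_character (hF : Module.Injective Sᵐᵒᵖ (CharacterModule F)) :
    EqFlat S F := by
  classical
  intro ι _ s x hx
  let rels : Set (ι → F) := {w | ∃ (t : ι → S) (y : F), ∑ i, s i * t i = 0 ∧ w = fun i => t i • y}
  suffices hmem : x ∈ AddSubgroup.closure rels by
    clear hx
    induction hmem using AddSubgroup.closure_induction with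
    | mem w hw =>
      obtain ⟨t, y, ht, rfl⟩ := hw
      exact ⟨Unit, inferInstance, fun i _ => t i, fun _ => y, by simp, fun _ => ht⟩
    | zero => exact ⟨Empty, inferInstance, fun _ => Empty.elim, Empty.elim, by simp, Empty.rec⟩
    | add v w _ _ hv hw =>
      obtain ⟨κ, _, a, y, h1, h2⟩ := hv
      obtain ⟨κ', _, a', y', h1', h2'⟩ := hw
      exact ⟨κ ⊕ κ', inferInstance, fun i => Sum.elim (a i) (a' i), Sum.elim y y',
        fun i => by simp [h1, h1'], by rintro (j | j); exacts [h2 j, h2' j]⟩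
    | neg v _ hv =>
      obtain ⟨κ, _, a, y, h1, h2⟩ := hv
      exact ⟨κ, inferInstance, a, fun j => -y j, fun i => by simp [h1], h2⟩
  by_contra hmem
  have hne : (QuotientAddGroup.mk x : (ι → F) ⧸ AddSubgroup.closure rels) ≠ 0 :=
    fun h => hmem ((QuotientAddGroup.eq_zero_iff x).1 h)
  obtain ⟨χ, hχ⟩ := CharacterModule.exists_character_apply_ne_zero_of_ne_zero hne
  let χ' : (ι → F) →+ AddCircle (1 : ℚ) :=
    AddMonoidHom.comp χ (QuotientAddGroup.mk' (AddSubgroup.closure rels))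
  have hχ' : ∀ (t : ι → S) (y : F), ∑ i, s i * t i = 0 → χ' (fun i => t i • y) = 0 := by
    intro t y ht
    have : (QuotientAddGroup.mk' (AddSubgroup.closure rels)) (fun i => t i • y) = 0 :=
      (QuotientAddGroup.eq_zero_iff _).2 (AddSubgroup.subset_closure ⟨t, y, ht, rfl⟩)
    change χ ((QuotientAddGroup.mk' (AddSubgroup.closure rels)) (fun i => t i • y)) = 0
    rw [this, map_zero]
  let lam : (ι → S) →ₗ[Sᵐᵒᵖ] S :=
    { toFun := fun t => ∑ i, s i * t i
      map_add' := fun t t' => by simp [mul_add, Finset.sum_add_distrib]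
      map_smul' := fun c t => by simp [Finset.sum_mul, mul_assoc] }
  let γ : (ι → S) →ₗ[Sᵐᵒᵖ] CharacterModule F :=
    { toFun := fun t => AddMonoidHom.comp χ'
        { toFun := fun y => fun i => t i • y
          map_zero' := by ext; simp
          map_add' := fun y y' => by ext; simp }
      map_add' := fun t t' => CharacterModule.ext _ fun y => by
        change χ' (fun i => (t i + t' i) • y) = χ' (fun i => t i • y) + χ' (fun i => t' i • y)
        rw [← map_add]
        congr 1
        ext i
        simp [add_smul]
      map_smul' := fun c t => CharacterModule.ext _ fun y => by
        change χ' (fun i => (t i * c.unop) • y) = χ' (fun i => t i • c.unop • y)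
        simp only [mul_smul] }
  obtain ⟨γ', hγ'⟩ := exists_comp_eq_of_baer (Module.Baer.of_injective hF) lam γ
    (fun t ht => CharacterModule.ext _ fun y => hχ' t y ht)
  apply hχ
  change χ' x = 0
  have hsingle : ∀ i, χ' (Pi.single i (x i)) = γ' 1 (s i • x i) := by
    intro i
    have h1 : γ (Pi.single i 1) = MulOpposite.op (s i) • γ' 1 := by
      rw [← hγ', LinearMap.comp_apply, ← map_smul]
      congr 1
      simp [lam, Pi.single_apply]
    have h2 := congrArg (fun φ : CharacterModule F => φ (x i)) h1
    refine Eq.trans (congrArg χ' ?_) h2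
    ext k
    by_cases hk : k = i
    · subst hk; simp
    · simp [hk]
  rw [← Finset.univ_sum_single x, map_sum]
  simp only [hsingle]
  rw [← map_sum, hx, map_zero]

/-- The character of `M ⊗_S F` that corresponds to a homomorphism from `M` to the character
module of `F`. -/
def balancedLift {M : Type u} [AddCommGroup M] [Module Sᵐᵒᵖ M]
    (g : M →ₗ[Sᵐᵒᵖ] CharacterModule F) : BalancedTensor S M F →+ AddCircle (1 : ℚ) :=
  QuotientAddGroup.lift _
    (TensorProduct.liftAddHom (g.toAddMonoidHom : M →+ (F →+ AddCircle (1 : ℚ)))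
      (fun r m x => by
        have : g (r • m) = r • g m := map_zsmul g.toAddMonoidHom r m
        change g (r • m) x = g m (r • x)
        rw [this]
        exact (map_zsmul (g m : F →+ AddCircle (1 : ℚ)) r x).symm))
    ((AddSubgroup.closure_le _).2 (by
      rintro _ ⟨m, s, x, rfl⟩
      simp only [SetLike.mem_coe, AddMonoidHom.mem_ker, map_sub]
      change g (MulOpposite.op s • m) x - g m (s • x) = 0
      rw [map_smul, op_smul_character_apply, MulOpposite.unop_op, sub_self]))

/-- The homomorphism from `M` to the character module of `F` that corresponds to a character of
`M ⊗_S F`. -/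
def balancedCurry {M : Type u} [AddCommGroup M] [Module Sᵐᵒᵖ M]
    (χ : BalancedTensor S M F →+ AddCircle (1 : ℚ)) : M →ₗ[Sᵐᵒᵖ] CharacterModule F where
  toFun m := χ.comp ((QuotientAddGroup.mk' (balancedRel S M F)).comp
    (TensorProduct.mk ℤ M F m).toAddMonoidHom)
  map_add' m m' := CharacterModule.ext _ fun x => by
    change χ (QuotientAddGroup.mk ((m + m') ⊗ₜ[ℤ] x)) = χ (QuotientAddGroup.mk (m ⊗ₜ[ℤ] x)) +
      χ (QuotientAddGroup.mk (m' ⊗ₜ[ℤ] x))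
    rw [TensorProduct.add_tmul, QuotientAddGroup.mk_add, map_add]
  map_smul' c m := CharacterModule.ext _ fun x => by
    change χ (QuotientAddGroup.mk ((c • m) ⊗ₜ[ℤ] x)) =
      χ (QuotientAddGroup.mk (m ⊗ₜ[ℤ] (c.unop • x)))
    congr 1
    rw [QuotientAddGroup.eq_iff_sub_mem]
    exact AddSubgroup.subset_closure ⟨m, c.unop, x, rfl⟩

theorem balancedTensor_hom_ext {M : Type u} [AddCommGroup M] [Module Sᵐᵒᵖ M]
    {A : Type*} [AddCommGroup A] {χ ψ : BalancedTensor S M F →+ A}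
    (h : ∀ m x, χ (QuotientAddGroup.mk (m ⊗ₜ[ℤ] x)) = ψ (QuotientAddGroup.mk (m ⊗ₜ[ℤ] x))) :
    χ = ψ := by
  refine QuotientAddGroup.addMonoidHom_ext _ (AddMonoidHom.ext fun t => ?_)
  induction t using TensorProduct.induction_on with
  | zero => simp
  | tmul m x => exact h m x
  | add a b ha hb => rw [map_add, map_add, ha, hb]

/-- Lambek's theorem: a module is flat if and only if its character module is injective. -/
theorem isFlat_iff_injective_character (F : ModuleCat.{u} S) :
    IsFlat F ↔ Module.Injective Sᵐᵒᵖ (CharacterModule F) := by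
  constructor
  · intro hF
    refine ⟨fun M N _ _ _ _ f hf g => ?_⟩
    obtain ⟨χ, hχ⟩ := exists_addMonoidHom_comp_eq (balancedMap S F f) (balancedLift g)
      (fun t ht => by
        rw [(injective_iff_map_eq_zero _).1 (hF M N f hf) t ht, map_zero])
    refine ⟨balancedCurry χ, fun m => CharacterModule.ext _ fun x => ?_⟩
    exact hχ (QuotientAddGroup.mk (m ⊗ₜ[ℤ] x))
  · intro hF M N _ _ _ _ f hf
    refine (injective_iff_map_eq_zero _).2 fun t ht => ?_
    by_contra hne
    obtain ⟨χ, hχ⟩ := CharacterModule.exists_character_apply_ne_zero_of_ne_zero hne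
    obtain ⟨g, hg⟩ := hF.out f hf (balancedCurry χ)
    apply hχ
    have : (balancedLift g).comp (balancedMap S F f) = χ :=
      balancedTensor_hom_ext fun m x => by
        have := congrArg (fun φ : CharacterModule F => φ x) (hg m)
        exact this
    calc χ t = (balancedLift g) (balancedMap S F f t) := (DFunLike.congr_fun this t).symm
      _ = 0 := by rw [ht, map_zero]

/-- The equational form is the one that speaks about `U`: over `S = End(U)`, matrices are maps
between finite powers of `U`. -/
theorem isFlat_iff_eqFlat (F : ModuleCat.{u} S) : IsFlat F ↔ EqFlat S F :=
  (isFlat_iff_injective_character F).trans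
    ⟨eqFlat_of_injective_character, EqFlat.injective_character⟩

/-- A linear section `σ : F → S^(F)` supplies the coefficients of the `x i`; the relations hold
because `σ` maps `∑ s_i x_i = 0` to zero. -/
theorem eqFlat_of_projective [Module.Projective S F] : EqFlat S F := by
  intro ι _ s x hx
  obtain ⟨σ, hσ⟩ := Module.projective_def'.1 (‹_› : Module.Projective S F)
  classical
  let t : Finset F := Finset.univ.biUnion fun i => (σ (x i)).support
  let e := t.equivFin.symm
  refine ⟨Fin t.card, inferInstance, fun i j => σ (x i) (e j), fun j => e j, fun i => ?_,
    fun j => ?_⟩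
  · have h1 : x i = Finsupp.linearCombination S id (σ (x i)) := (LinearMap.congr_fun hσ (x i)).symm
    have h2 : (σ (x i)).support ⊆ t :=
      Finset.subset_biUnion_of_mem (fun i => (σ (x i)).support) (Finset.mem_univ i)
    conv_lhs => rw [h1]
    rw [Finsupp.linearCombination_apply, Finsupp.sum_of_support_subset _ h2 _ (by simp),
      ← Finset.sum_coe_sort, ← e.sum_comp]
    rfl
  · have := congrArg (fun v => v (e j : F)) (congrArg σ hx)
    simpa [Finsupp.finsetSum_apply] using this

end Flat


/-! ### Finite resolutions -/

section Resolution

variable {R : Type u} [Ring R] {X Y : ModuleCat.{u} R → Prop}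

/-- The length `k ≤ n` is kept, since a shorter resolution can be padded with zeros only if the
class `X` contains zero. -/
theorem resolDim_le_iff {A : ModuleCat.{u} R} {n : ℕ} :
    resolDim X A ≤ n ↔ ∃ k ≤ n, HasResolutionOfLength X A k := by
  constructor
  · intro h
    have hne : {m : ℕ∞ | ∃ k : ℕ, m = k ∧ HasResolutionOfLength X A k}.Nonempty := by
      by_contra hne
      rw [resolDim, Set.not_nonempty_iff_eq_empty.1 hne, sInf_empty] at h
      exact absurd h (by simp)
    obtain ⟨k, hk, hres⟩ := csInf_mem hne
    refine ⟨k, ?_, hres⟩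
    rw [resolDim, hk] at h
    exact_mod_cast h
  · rintro ⟨k, hk, hres⟩
    exact (sInf_le ⟨k, rfl, hres⟩ : resolDim X A ≤ k).trans (by exact_mod_cast hk)

theorem resolDim_lt_top_iff {A : ModuleCat.{u} R} :
    resolDim X A < ⊤ ↔ ∃ k, HasResolutionOfLength X A k := by
  constructor
  · intro h
    obtain ⟨n, hn⟩ := ENat.ne_top_iff_exists.1 h.ne
    obtain ⟨k, -, hk⟩ := resolDim_le_iff.1 hn.symm.le
    exact ⟨k, hk⟩
  · rintro ⟨k, hk⟩
    exact lt_of_le_of_lt (resolDim_le_iff.2 ⟨k, le_rfl, hk⟩) (ENat.natCast_lt_top k)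

theorem HasResolutionOfLength.mono (h : ∀ A, X A → Y A) {A : ModuleCat.{u} R} {m : ℕ}
    (hA : HasResolutionOfLength X A m) : HasResolutionOfLength Y A m := by
  obtain ⟨T, d, ε, hT, hrest⟩ := hA
  exact ⟨T, d, ε, fun i hi => h _ (hT i hi), hrest⟩

theorem hasResolutionOfLength_zero {A T : ModuleCat.{u} R} (hT : X T) (e : T ≃ₗ[R] A) :
    HasResolutionOfLength X A 0 := by
  refine ⟨fun i => Nat.casesOn i T (fun _ => ModuleCat.of R PUnit), fun _ => 0, e.toLinearMap,
    ?_, ?_, e.surjective, ?_, ?_⟩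
  · intro i hi
    obtain rfl : i = 0 := by omega
    exact hT
  · rintro (_ | i) hi
    · omega
    · exact inferInstanceAs (Subsingleton PUnit)
  · intro y
    constructor
    · intro hy
      exact ⟨0, by simpa using (e.map_eq_zero_iff.1 hy).symm⟩
    · rintro ⟨x, rfl⟩
      simp
  · intro i y
    have : Subsingleton ((fun i => Nat.casesOn i T (fun _ => ModuleCat.of R PUnit) :
      ℕ → ModuleCat.{u} R) (i + 1)) := inferInstanceAs (Subsingleton PUnit)
    exact ⟨fun _ => ⟨0, Subsingleton.elim _ _⟩, fun _ => rfl⟩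

theorem HasResolutionOfLength.exists_equiv {A : ModuleCat.{u} R}
    (h : HasResolutionOfLength X A 0) : ∃ T, X T ∧ Nonempty (T ≃ₗ[R] A) := by
  obtain ⟨T, d, ε, hT, h0, hs, he, -⟩ := h
  have := h0 1 (by omega)
  refine ⟨T 0, hT 0 le_rfl, ⟨LinearEquiv.ofBijective ε
    ⟨(injective_iff_map_eq_zero ε).2 fun x hx => ?_, hs⟩⟩⟩
  obtain ⟨y, rfl⟩ := (he x).1 hx
  rw [Subsingleton.elim y 0, map_zero]

/-- The sequence of modules `T, T' 0, T' 1, …`. -/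
def consObj (T : ModuleCat.{u} R) (T' : ℕ → ModuleCat.{u} R) : ℕ → ModuleCat.{u} R
  | 0 => T
  | i + 1 => T' i

/-- The sequence of maps `h, d 0, d 1, …` between the terms of `consObj T T'`. -/
def consMap {T : ModuleCat.{u} R} (T' : ℕ → ModuleCat.{u} R) (d : ∀ i, T' (i + 1) →ₗ[R] T' i)
    (h : T' 0 →ₗ[R] T) : ∀ i, consObj T T' (i + 1) →ₗ[R] consObj T T' i
  | 0 => h
  | i + 1 => d i

/-- Together with its converse `HasResolutionOfLength.exists_shortExact`, this lets inductions on
the length handle one short exact sequence at a time. -/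
theorem hasResolutionOfLength_succ {K T A : ModuleCat.{u} R} {m : ℕ} (f : K →ₗ[R] T)
    (g : T →ₗ[R] A) (hf : Function.Injective f) (hfg : Function.Exact f g)
    (hg : Function.Surjective g) (hT : X T) (hK : HasResolutionOfLength X K m) :
    HasResolutionOfLength X A (m + 1) := by
  obtain ⟨T', d, ε, hT', h0, hs, he, hd⟩ := hK
  refine ⟨consObj T T', consMap T' d (f.comp ε), g, ?_, ?_, hg, ?_, ?_⟩
  · rintro (_ | i) hi
    · exact hT
    · exact hT' i (by omega)
  · rintro (_ | i) hi
    · omega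
    · exact h0 i (by omega)
  · intro y
    refine (hfg y).trans ?_
    constructor
    · rintro ⟨k, rfl⟩
      obtain ⟨t, rfl⟩ := hs k
      exact ⟨t, rfl⟩
    · rintro ⟨t, rfl⟩
      exact ⟨ε t, rfl⟩
  · rintro (_ | i)
    · intro y
      refine Iff.trans ?_ (he y)
      exact ⟨fun h => hf (h.trans (map_zero f).symm), fun h => (congrArg f h).trans (map_zero f)⟩
    · exact hd i

theorem HasResolutionOfLength.exists_shortExact {A : ModuleCat.{u} R} {m : ℕ}
    (h : HasResolutionOfLength X A (m + 1)) :
    ∃ (K T : ModuleCat.{u} R) (f : K →ₗ[R] T) (g : T →ₗ[R] A), Function.Injective f ∧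
      Function.Exact f g ∧ Function.Surjective g ∧ X T ∧ HasResolutionOfLength X K m := by
  obtain ⟨T, d, ε, hT, h0, hs, he, hd⟩ := h
  refine ⟨ModuleCat.of R (LinearMap.ker ε), T 0, (LinearMap.ker ε).subtype, ε,
    Subtype.val_injective, fun y => by simp, hs, hT 0 (by omega), ?_⟩
  have hmem : ∀ x, d 0 x ∈ LinearMap.ker ε := fun x => (he _).2 ⟨x, rfl⟩
  refine ⟨fun i => T (i + 1), fun i => d (i + 1), (d 0).codRestrict _ hmem,
    fun i hi => hT _ (by omega), fun i hi => h0 _ (by omega), ?_, ?_, fun i => hd (i + 1)⟩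
  · rintro ⟨y, hy⟩
    obtain ⟨x, rfl⟩ := (he y).1 hy
    exact ⟨x, rfl⟩
  · intro y
    rw [← hd 0 y, ← Subtype.val_inj]
    rfl

end Resolution

/-! ### Short exact sequences and `Ext` -/

section Ext

variable {R : Type u} [Ring R]

/-- The short complex given by an exact pair of linear maps. -/
abbrev shortComplexOf {A B C : ModuleCat.{u} R} (f : A →ₗ[R] B) (g : B →ₗ[R] C)
    (hfg : Function.Exact f g) : ShortComplex (ModuleCat.{u} R) :=
  ShortComplex.mk (ModuleCat.ofHom f) (ModuleCat.ofHom g)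
    (ModuleCat.hom_ext hfg.linearMap_comp_eq_zero)

theorem shortExact_of {A B C : ModuleCat.{u} R} {f : A →ₗ[R] B} {g : B →ₗ[R] C}
    (hf : Function.Injective f) (hfg : Function.Exact f g) (hg : Function.Surjective g) :
    (shortComplexOf f g hfg).ShortExact :=
  ModuleCat.shortComplex_shortExact _ hfg hf hg

theorem projective_module_iff (A : ModuleCat.{u} R) : Module.Projective R A ↔ Projective A :=
  IsProjective.iff_projective A

theorem injective_module_iff (A : ModuleCat.{u} R) : Module.Injective R A ↔ Injective A :=
  Module.injective_iff_injective_object R A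

variable {A B C X : ModuleCat.{u} R} {f : A →ₗ[R] B} {g : B →ₗ[R] C}

theorem exists_extension_of_ext_one (hf : Function.Injective f) (hfg : Function.Exact f g)
    (hg : Function.Surjective g) [hX : Subsingleton (Abelian.Ext.{u} C X 1)] (h : A →ₗ[R] X) :
    ∃ h' : B →ₗ[R] X, h'.comp f = h := by
  obtain ⟨x, hx⟩ := Abelian.Ext.contravariant_sequence_exact₁ (shortExact_of hf hfg hg) X
    (Abelian.Ext.mk₀ (ModuleCat.ofHom h)) (n₁ := 1) (by omega) (hX.elim _ _)
  obtain ⟨φ, rfl⟩ := Abelian.Ext.mk₀_bijective _ _ |>.2 x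
  rw [Abelian.Ext.mk₀_comp_mk₀] at hx
  have := (Abelian.Ext.mk₀_bijective _ _).1 hx
  exact ⟨φ.hom, congrArg ModuleCat.Hom.hom this⟩

theorem exists_lift_of_ext_one (hf : Function.Injective f) (hfg : Function.Exact f g)
    (hg : Function.Surjective g) [hX : Subsingleton (Abelian.Ext.{u} X A 1)] (h : X →ₗ[R] C) :
    ∃ h' : X →ₗ[R] B, g.comp h' = h := by
  obtain ⟨x, hx⟩ := Abelian.Ext.covariant_sequence_exact₃ X (shortExact_of hf hfg hg)
    (Abelian.Ext.mk₀ (ModuleCat.ofHom h)) (n₁ := 1) (by omega) (hX.elim _ _)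
  obtain ⟨φ, rfl⟩ := Abelian.Ext.mk₀_bijective _ _ |>.2 x
  rw [Abelian.Ext.mk₀_comp_mk₀] at hx
  have := (Abelian.Ext.mk₀_bijective _ _).1 hx
  exact ⟨φ.hom, congrArg ModuleCat.Hom.hom this⟩

/-- Since `Ext^1(B, X) = 0`, each class in `Ext^1(C, X)` is the connecting image of some `A → X`; a
map that extends to `B` has image zero. -/
theorem ext_one_subsingleton_of_extension (hf : Function.Injective f) (hfg : Function.Exact f g)
    (hg : Function.Surjective g) (hB : Subsingleton (Abelian.Ext.{u} B X 1))
    (hext : ∀ h : A →ₗ[R] X, ∃ h' : B →ₗ[R] X, h'.comp f = h) :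
    Subsingleton (Abelian.Ext.{u} C X 1) := by
  refine subsingleton_of_forall_eq 0 fun x => ?_
  obtain ⟨y, rfl⟩ := Abelian.Ext.contravariant_sequence_exact₃ (shortExact_of hf hfg hg) X x
    (hB.elim _ _) (n₀ := 0) (by omega)
  obtain ⟨φ, rfl⟩ := Abelian.Ext.mk₀_bijective _ _ |>.2 y
  obtain ⟨φ', hφ'⟩ := hext φ.hom
  have : φ = (shortComplexOf f g hfg).f ≫ ModuleCat.ofHom φ' := ModuleCat.hom_ext hφ'.symm
  rw [this, ← Abelian.Ext.mk₀_comp_mk₀]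
  exact (shortExact_of hf hfg hg).extClass_comp_assoc _

theorem ext_one_subsingleton_of_lift (hf : Function.Injective f) (hfg : Function.Exact f g)
    (hg : Function.Surjective g) (hB : Subsingleton (Abelian.Ext.{u} X B 1))
    (hlift : ∀ h : X →ₗ[R] C, ∃ h' : X →ₗ[R] B, g.comp h' = h) :
    Subsingleton (Abelian.Ext.{u} X A 1) := by
  refine subsingleton_of_forall_eq 0 fun x => ?_
  obtain ⟨y, rfl⟩ := Abelian.Ext.covariant_sequence_exact₁ X (shortExact_of hf hfg hg) x
    (hB.elim _ _) (n₀ := 0) (by omega)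
  obtain ⟨φ, rfl⟩ := Abelian.Ext.mk₀_bijective _ _ |>.2 y
  obtain ⟨φ', hφ'⟩ := hlift φ.hom
  have : φ = ModuleCat.ofHom φ' ≫ (shortComplexOf f g hfg).g := ModuleCat.hom_ext hφ'.symm
  rw [this, ← Abelian.Ext.mk₀_comp_mk₀, Abelian.Ext.comp_assoc_of_second_deg_zero,
    ShortComplex.ShortExact.comp_extClass, Abelian.Ext.comp_zero]

theorem ext_subsingleton_right₁ (hf : Function.Injective f) (hfg : Function.Exact f g)
    (hg : Function.Surjective g) {i : ℕ} (hB : Subsingleton (Abelian.Ext.{u} X B (i + 1)))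
    (hC : Subsingleton (Abelian.Ext.{u} X C i)) :
    Subsingleton (Abelian.Ext.{u} X A (i + 1)) := by
  refine subsingleton_of_forall_eq 0 fun x => ?_
  obtain ⟨y, rfl⟩ := Abelian.Ext.covariant_sequence_exact₁ X (shortExact_of hf hfg hg) x
    (hB.elim _ _) rfl
  rw [hC.elim y 0, Abelian.Ext.zero_comp]

theorem ext_subsingleton_right₃ (hf : Function.Injective f) (hfg : Function.Exact f g)
    (hg : Function.Surjective g) {i : ℕ} (hB : Subsingleton (Abelian.Ext.{u} X B i))
    (hA : Subsingleton (Abelian.Ext.{u} X A (i + 1))) :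
    Subsingleton (Abelian.Ext.{u} X C i) := by
  refine subsingleton_of_forall_eq 0 fun x => ?_
  obtain ⟨y, rfl⟩ := Abelian.Ext.covariant_sequence_exact₃ X (shortExact_of hf hfg hg) x
    rfl (hA.elim _ _)
  rw [hB.elim y 0, Abelian.Ext.zero_comp]

theorem ext_subsingleton_left₁ (hf : Function.Injective f) (hfg : Function.Exact f g)
    (hg : Function.Surjective g) {i : ℕ} (hB : Subsingleton (Abelian.Ext.{u} B X i))
    (hC : Subsingleton (Abelian.Ext.{u} C X (i + 1))) :
    Subsingleton (Abelian.Ext.{u} A X i) := by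
  refine subsingleton_of_forall_eq 0 fun x => ?_
  obtain ⟨y, rfl⟩ := Abelian.Ext.contravariant_sequence_exact₁ (shortExact_of hf hfg hg) X x
    (add_comm 1 i) (hC.elim _ _)
  rw [hB.elim y 0, Abelian.Ext.comp_zero]

theorem ext_subsingleton_left₃ (hf : Function.Injective f) (hfg : Function.Exact f g)
    (hg : Function.Surjective g) {i : ℕ} (hB : Subsingleton (Abelian.Ext.{u} B X (i + 1)))
    (hA : Subsingleton (Abelian.Ext.{u} A X i)) :
    Subsingleton (Abelian.Ext.{u} C X (i + 1)) := by
  refine subsingleton_of_forall_eq 0 fun x => ?_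
  obtain ⟨y, rfl⟩ := Abelian.Ext.contravariant_sequence_exact₃ (shortExact_of hf hfg hg) X x
    (hB.elim _ _) (add_comm 1 i)
  rw [hA.elim y 0, Abelian.Ext.comp_zero]

theorem exists_injective_embedding (X : ModuleCat.{u} R) :
    ∃ (J C : ModuleCat.{u} R) (f : X →ₗ[R] J) (g : J →ₗ[R] C), Injective J ∧
      Function.Injective f ∧ Function.Exact f g ∧ Function.Surjective g := by
  obtain ⟨J, hJ, f, hf⟩ := EnoughInjectives.presentation X
  exact ⟨J, ModuleCat.of R (J ⧸ f.hom.range), f.hom, f.hom.range.mkQ, hJ,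
    (ModuleCat.mono_iff_injective f).1 hf, f.hom.exact_map_mkQ_range,
    Submodule.mkQ_surjective _⟩

/-- Baer's criterion for the injective dimension. -/
theorem hasInjectiveDimensionLE_of_ext_quotient (n : ℕ) (X : ModuleCat.{u} R)
    (h : ∀ I : Ideal R, Subsingleton (Abelian.Ext.{u} (ModuleCat.of R (R ⧸ I)) X (n + 1))) :
    HasInjectiveDimensionLE X n := by
  induction n generalizing X with
  | zero =>
    have hinj : Module.Injective R X := Module.Baer.injective fun I g => by
      have := h I
      obtain ⟨g', hg'⟩ := exists_extension_of_ext_one (A := ModuleCat.of R I)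
        (B := ModuleCat.of R R) (C := ModuleCat.of R (R ⧸ I)) (X := X) (f := I.subtype)
        (g := Submodule.mkQ I) Subtype.val_injective (LinearMap.exact_subtype_mkQ I)
        (Submodule.mkQ_surjective I) g
      exact ⟨g', fun x hx => LinearMap.congr_fun hg' ⟨x, hx⟩⟩
    exact injective_iff_hasInjectiveDimensionLT_one.1 ((injective_module_iff X).1 hinj)
  | succ n ih =>
    obtain ⟨J, C, f, g, hJ, hf, hfg, hg⟩ := exists_injective_embedding X
    refine ((shortExact_of hf hfg hg).hasInjectiveDimensionLT_X₃_iff n hJ).1 (ih C fun I => ?_)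
    exact ext_subsingleton_right₃ hf hfg hg (Abelian.Ext.subsingleton_of_injective _ _ _) (h I)

/-- If `Ext^i(U, X)` vanishes, so does `Ext^i` of every direct sum of copies of `U`. -/
theorem ext_finsupp_subsingleton (U : ModuleCat.{u} R) (I : Type u) (i : ℕ) (X : ModuleCat.{u} R)
    (h : Subsingleton (Abelian.Ext.{u} U X (i + 1))) :
    Subsingleton (Abelian.Ext.{u} (ModuleCat.of R (I →₀ U)) X (i + 1)) := by
  induction i generalizing X with
  | zero =>
    obtain ⟨J, C, f, g, hJ, hf, hfg, hg⟩ := exists_injective_embedding X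
    refine ext_one_subsingleton_of_lift hf hfg hg
      (Abelian.Ext.subsingleton_of_injective _ _ _) fun φ => ?_
    -- Lifts along `J → C` may be chosen on each copy of `U` separately; they assemble on the direct
    -- sum.
    choose ψ hψ using fun a : I => exists_lift_of_ext_one hf hfg hg (X := U)
      (φ.comp (Finsupp.lsingle a : U →ₗ[R] (I →₀ U)))
    refine ⟨Finsupp.lsum ℕ ψ, Finsupp.lhom_ext' fun a => ?_⟩
    rw [← hψ a]
    ext x
    simp
  | succ i ih =>
    obtain ⟨J, C, f, g, hJ, hf, hfg, hg⟩ := exists_injective_embedding X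
    exact ext_subsingleton_right₁ hf hfg hg (Abelian.Ext.subsingleton_of_injective _ _ _)
      (ih C (ext_subsingleton_right₃ hf hfg hg (Abelian.Ext.subsingleton_of_injective _ _ _) h))

theorem hasProjectiveDimensionLE_iff_hasResolutionOfLength (A : ModuleCat.{u} R) (n : ℕ) :
    HasProjectiveDimensionLE A n ↔
      HasResolutionOfLength (fun P : ModuleCat.{u} R => Module.Projective R P) A n := by
  induction n generalizing A with
  | zero =>
    rw [← projective_iff_hasProjectiveDimensionLE_zero, ← projective_module_iff]
    constructor
    · exact fun h => hasResolutionOfLength_zero (T := A) h (LinearEquiv.refl R A)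
    · intro h
      obtain ⟨T, hT, ⟨e⟩⟩ := h.exists_equiv
      exact Module.Projective.of_equiv e
  | succ n ih =>
    constructor
    · intro h
      have hses := A.shortExact_projectiveShortComplex
      have hP : Module.Projective R A.projectiveShortComplex.X₂ := inferInstance
      refine hasResolutionOfLength_succ A.projectiveShortComplex.f.hom
        A.projectiveShortComplex.g.hom hses.moduleCat_injective_f ?_ hses.moduleCat_surjective_g
        hP ((ih _).1 ((hses.hasProjectiveDimensionLT_X₃_iff n ?_).1 h))
      · exact (ShortComplex.ShortExact.moduleCat_exact_iff_function_exact _).1 hses.exact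
      · exact (projective_module_iff _).1 hP
    · intro h
      obtain ⟨K, T, f, g, hf, hfg, hg, hT, hK⟩ := h.exists_shortExact
      exact ((shortExact_of hf hfg hg).hasProjectiveDimensionLT_X₃_iff n
        ((projective_module_iff _).1 hT)).2 ((ih K).2 hK)

theorem projDim_le_iff (A : ModuleCat.{u} R) (n : ℕ) :
    projDim A ≤ n ↔ HasProjectiveDimensionLE A n := by
  rw [← projectiveDimension_le_iff, projDim]
  generalize projectiveDimension A = d
  cases d with
  | bot => simp
  | coe d => exact (WithBot.coe_le_coe (b := (n : ℕ∞))).symm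

theorem injDim_le_iff (A : ModuleCat.{u} R) (n : ℕ) :
    injDim A ≤ n ↔ HasInjectiveDimensionLE A n := by
  rw [← injectiveDimension_le_iff, injDim]
  generalize injectiveDimension A = d
  cases d with
  | bot => simp
  | coe d => exact (WithBot.coe_le_coe (b := (n : ℕ∞))).symm

theorem projDim_lt_top_iff (A : ModuleCat.{u} R) :
    projDim A < ⊤ ↔ ∃ n, HasProjectiveDimensionLE A n := by
  simp only [← projDim_le_iff]
  constructor
  · intro h
    obtain ⟨n, hn⟩ := ENat.ne_top_iff_exists.1 h.ne
    exact ⟨n, hn.symm.le⟩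
  · rintro ⟨n, hn⟩
    exact lt_of_le_of_lt hn (ENat.natCast_lt_top n)

end Ext


/-! ### Modules in which finitely generated pieces factor through powers of `U` -/

section LocallyAdd

variable {R : Type u} [Ring R]

/-- A map that vanishes on the kernel of a surjection factors through it. -/
theorem exists_comp_eq_of_surjective {A B C : Type*} [AddCommGroup A] [Module R A]
    [AddCommGroup B] [Module R B] [AddCommGroup C] [Module R C] {π : A →ₗ[R] B}
    (hπ : Function.Surjective π) (g : A →ₗ[R] C) (hg : LinearMap.ker π ≤ LinearMap.ker g) :
    ∃ g' : B →ₗ[R] C, g'.comp π = g := by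
  refine ⟨((LinearMap.ker π).liftQ g hg).comp
    (π.quotKerEquivOfSurjective hπ).symm.toLinearMap, LinearMap.ext fun a => ?_⟩
  have : (π.quotKerEquivOfSurjective hπ).symm (π a) = Submodule.Quotient.mk a := by
    rw [LinearEquiv.symm_apply_eq]
    rfl
  simp only [LinearMap.comp_apply, LinearEquiv.coe_coe, this, Submodule.liftQ_apply]

/-- Every homomorphism from a finitely generated module to `T` factors through a finite direct sum
of copies of `U`. -/
def LocallyAdd (U T : ModuleCat.{u} R) : Prop :=
  ∀ (M : Type u) [AddCommGroup M] [Module R M] [Module.Finite R M] (g : M →ₗ[R] T),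
    ∃ (κ : Type) (_ : Fintype κ) (β : M →ₗ[R] (κ → U)) (y : (κ → U) →ₗ[R] T), y.comp β = g

variable {U : ModuleCat.{u} R}

theorem LocallyAdd.of_isSummand {T T' : ModuleCat.{u} R} (hT' : LocallyAdd U T')
    (h : IsSummand (R := R) T T') : LocallyAdd U T := by
  obtain ⟨i, p, hpi⟩ := h
  intro M _ _ _ g
  obtain ⟨κ, _, β, y, hy⟩ := hT' M (i.comp g)
  exact ⟨κ, inferInstance, β, p.comp y, by
    rw [LinearMap.comp_assoc, hy, ← LinearMap.comp_assoc, hpi, LinearMap.id_comp]⟩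

theorem exists_finite_free_cover [IsNoetherianRing R] (M : ModuleCat.{u} R) [Module.Finite R M] :
    ∃ (a : ℕ) (N : ModuleCat.{u} R) (f : N →ₗ[R] (Fin a → R)) (g : (Fin a → R) →ₗ[R] M),
      Module.Finite R N ∧ Function.Injective f ∧ Function.Exact f g ∧ Function.Surjective g := by
  obtain ⟨a, g, hg⟩ := Module.Finite.exists_fin' R M
  exact ⟨a, ModuleCat.of R (LinearMap.ker g), (LinearMap.ker g).subtype, g,
    inferInstanceAs (Module.Finite R (LinearMap.ker g)), Subtype.val_injective,
    fun y => by simp, hg⟩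

/-- Over a noetherian ring the vanishing of `Ext^i(M, U)` for a finitely generated module `M`
passes to the modules that are locally in `add U`. -/
theorem LocallyAdd.ext_subsingleton [IsNoetherianRing R] {T : ModuleCat.{u} R}
    (hT : LocallyAdd U T) (i : ℕ) (M : ModuleCat.{u} R) [Module.Finite R M]
    (h : Subsingleton (Abelian.Ext.{u} M U (i + 1))) :
    Subsingleton (Abelian.Ext.{u} M T (i + 1)) := by
  induction i generalizing M with
  | zero =>
    obtain ⟨a, N, f, g, hN, hf, hfg, hg⟩ := exists_finite_free_cover M
    have hP : Projective (ModuleCat.of R (Fin a → R)) :=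
      (projective_module_iff _).1 (inferInstanceAs (Module.Projective R (Fin a → R)))
    refine ext_one_subsingleton_of_extension (B := ModuleCat.of R (Fin a → R)) hf hfg hg
      (Abelian.Ext.subsingleton_of_projective _ _ _) fun φ => ?_
    -- As `N` is finitely generated, `φ` factors through `U^κ`, and each coordinate `N → U` extends
    -- to the free module because `Ext^1(M, U) = 0`.
    obtain ⟨κ, _, β, y, rfl⟩ := hT N φ
    choose ψ hψ using fun k : κ => exists_extension_of_ext_one (B := ModuleCat.of R (Fin a → R))
      hf hfg hg (X := U) ((LinearMap.proj k).comp β)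
    refine ⟨y.comp (LinearMap.pi ψ), ?_⟩
    rw [LinearMap.comp_assoc]
    congr 1
    ext x k
    exact LinearMap.congr_fun (hψ k) x
  | succ i ih =>
    obtain ⟨a, N, f, g, hN, hf, hfg, hg⟩ := exists_finite_free_cover M
    have hP : Projective (ModuleCat.of R (Fin a → R)) :=
      (projective_module_iff _).1 (inferInstanceAs (Module.Projective R (Fin a → R)))
    exact ext_subsingleton_left₃ (B := ModuleCat.of R (Fin a → R)) hf hfg hg
      (Abelian.Ext.subsingleton_of_projective _ _ _)
      (ih N (ext_subsingleton_left₁ (B := ModuleCat.of R (Fin a → R)) hf hfg hg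
        (Abelian.Ext.subsingleton_of_projective _ _ _) h))

theorem LocallyAdd.hasInjectiveDimensionLE [IsNoetherianRing R] {T : ModuleCat.{u} R}
    (hT : LocallyAdd U T) {n : ℕ} (hU : HasInjectiveDimensionLE U n) :
    HasInjectiveDimensionLE T n :=
  hasInjectiveDimensionLE_of_ext_quotient n T fun I =>
    have : Module.Finite R (ModuleCat.of R (R ⧸ I)) :=
      inferInstanceAs (Module.Finite R (R ⧸ I))
    hT.ext_subsingleton n _ (HasInjectiveDimensionLT.subsingleton U (n + 1) (n + 1) le_rfl _)

/-- A direct limit over a directed set is locally in `add U` if its terms are finite powers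
of `U`. -/
theorem IsAddLim.locallyAdd [IsNoetherianRing R] {T : ModuleCat.{u} R} (hT : IsAddLim U T) :
    LocallyAdd U T := by
  obtain ⟨I, _, _, _, _, k, f, _, hsum⟩ := hT
  refine LocallyAdd.of_isSummand (T' := ModuleCat.of R (Module.DirectLimit _ f)) ?_ hsum
  intro M _ _ _ φ
  change M →ₗ[R] Module.DirectLimit (fun i => Fin (k i) → U) f at φ
  obtain ⟨a, π, hπ⟩ := Module.Finite.exists_fin' R M
  -- `M` is finitely presented: the images of its generators lift to one stage `j`, and its finitely
  -- many relations, zero in the limit, already vanish at a later stage `m`.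
  choose i x hx using fun c : Fin a => Module.DirectLimit.exists_of (φ (π (Pi.single c 1)))
  obtain ⟨j, hj⟩ := Finite.exists_le i
  let G : (Fin a → R) →ₗ[R] (Fin (k j) → U) :=
    (Pi.basisFun R (Fin a)).constr ℕ fun c => f (i c) j (hj c) (x c)
  have hG : (Module.DirectLimit.of R I (fun i => Fin (k i) → U) f j).comp G = φ.comp π := by
    refine (Pi.basisFun R (Fin a)).ext fun c => ?_
    rw [LinearMap.comp_apply, Module.Basis.constr_basis, Module.DirectLimit.of_f, hx,
      Pi.basisFun_apply, LinearMap.comp_apply]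
  obtain ⟨b, γ, hγ⟩ := Module.Finite.exists_fin' R (LinearMap.ker π)
  have hz : ∀ c : Fin b, ∃ (j' : I) (hjj' : j ≤ j'), f j j' hjj' (G (γ (Pi.single c 1))) = 0 := by
    intro c
    apply Module.DirectLimit.of.zero_exact
    rw [← LinearMap.comp_apply, hG, LinearMap.comp_apply, (γ (Pi.single c 1)).2, map_zero]
  choose j' hjj' hz using hz
  obtain ⟨l, hl⟩ := Finite.exists_le j'
  obtain ⟨m, hjm, hlm⟩ := exists_ge_ge j l
  have hker : LinearMap.ker π ≤ LinearMap.ker ((f j m hjm).comp G) := by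
    intro v hv
    obtain ⟨w, hw⟩ := hγ ⟨v, hv⟩
    have h0 : ((f j m hjm).comp G).comp ((LinearMap.ker π).subtype.comp γ) = 0 := by
      refine (Pi.basisFun R (Fin b)).ext fun c => ?_
      have hm := (hl c).trans hlm
      have hm' := DirectedSystem.map_map' (f := fun i j h => f i j h) (hjj' c) hm
        (G (γ (Pi.single c 1)))
      rw [hz c, map_zero] at hm'
      rw [Pi.basisFun_apply]
      exact hm'.symm
    have := LinearMap.congr_fun h0 w
    simpa [hw] using this
  obtain ⟨β, hβ⟩ := exists_comp_eq_of_surjective hπ _ hker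
  refine ⟨Fin (k m), inferInstance, β, Module.DirectLimit.of R I (fun i => Fin (k i) → U) f m, ?_⟩
  refine LinearMap.ext fun v => ?_
  obtain ⟨w, rfl⟩ := hπ v
  rw [LinearMap.comp_apply, ← LinearMap.comp_apply β, hβ, LinearMap.comp_apply,
    Module.DirectLimit.of_f]
  exact LinearMap.congr_fun hG w

/-- `U^(I)` is the directed union of its subsums over finite subsets of `I`, each rewritten as a
power indexed by `Fin`. Only a retraction of the limit onto `U^(I)` is needed, because the class is
closed under summands. -/
theorem IsAdd.isAddLim {T : ModuleCat.{u} R} (hT : IsAdd U T) : IsAddLim U T := by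
  classical
  obtain ⟨I, i, p, hpi⟩ := hT
  let e : ∀ s : Finset I, Fin s.card → I := fun s c => s.equivFin.symm c
  let incl : ∀ s : Finset I, (Fin s.card → U) →ₗ[R] (I →₀ U) := fun s =>
    LinearMap.lsum R (fun _ => U) ℕ fun c => Finsupp.lsingle (e s c)
  let res : ∀ s : Finset I, (I →₀ U) →ₗ[R] (Fin s.card → U) := fun s =>
    LinearMap.pi fun c => Finsupp.lapply (e s c)
  have he : ∀ s : Finset I, Function.Injective (e s) := fun s =>
    Subtype.val_injective.comp s.equivFin.symm.injective
  have hri : ∀ s, (res s).comp (incl s) = LinearMap.id := by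
    intro s
    refine LinearMap.pi_ext fun c u => ?_
    ext d
    simp [res, incl, Finsupp.single_apply, (he s).eq_iff, Pi.single_apply, eq_comm]
  -- `incl t ∘ res t` truncates to the coordinates in `t`, so it fixes the subsum over `s`. This
  -- gives both functoriality of the system and compatibility of the inclusions.
  have hir : ∀ s t, s ≤ t → ((incl t).comp (res t)).comp (incl s) = incl s := by
    intro s t hst
    refine LinearMap.pi_ext fun c u => ?_
    have hmem : e s c ∈ t := hst (s.equivFin.symm c).2
    obtain ⟨d, hd⟩ : ∃ d, e t d = e s c := ⟨t.equivFin ⟨_, hmem⟩, by simp [e]⟩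
    have h1 : incl s (Pi.single c u) = Finsupp.single (e s c) u := by
      simp only [incl, LinearMap.lsum_piSingle, Finsupp.lsingle_apply]
    have h2 : incl t (Pi.single d u) = Finsupp.single (e s c) u := by
      simp only [incl, LinearMap.lsum_piSingle, Finsupp.lsingle_apply, hd]
    rw [LinearMap.comp_apply, h1, ← h2, LinearMap.comp_apply, ← LinearMap.comp_apply (res t), hri,
      LinearMap.id_apply]
  let f : ∀ s t : Finset I, s ≤ t → (Fin s.card → U) →ₗ[R] (Fin t.card → U) := fun s t _ =>
    (res t).comp (incl s)
  have hds : DirectedSystem (fun s : Finset I => Fin s.card → U) (fun s t h => f s t h) :=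
    { map_self := fun s x => LinearMap.congr_fun (hri s) x
      map_map := fun s t v hst htv x => by
        exact congrArg (res _) (LinearMap.congr_fun (hir _ _ hst) x) }
  refine ⟨Finset I, inferInstance, inferInstance, inferInstance, inferInstance, Finset.card, f,
    hds, ?_⟩
  let toLim : (I →₀ U) →ₗ[R] Module.DirectLimit (fun s : Finset I => Fin s.card → U) f :=
    Finsupp.lsum ℕ fun a => (Module.DirectLimit.of R (Finset I) _ f {a}).comp
      (LinearMap.pi fun _ => LinearMap.id)
  let ofLim : Module.DirectLimit (fun s : Finset I => Fin s.card → U) f →ₗ[R] (I →₀ U) :=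
    Module.DirectLimit.lift R (Finset I) _ f incl fun s t hst x =>
      LinearMap.congr_fun (hir s t hst) x
  have hcomp : ofLim.comp toLim = LinearMap.id := by
    refine Finsupp.lhom_ext fun a u => ?_
    have hea : ∀ c, e {a} c = a := fun c => Finset.mem_singleton.1 (Finset.equivFin {a} |>.symm c).2
    simp only [toLim, ofLim, LinearMap.comp_apply, Finsupp.lsum_single, LinearMap.id_apply,
      Module.DirectLimit.lift_of]
    simp [incl, hea]
  refine ⟨toLim.comp i, p.comp ofLim, ?_⟩
  rw [LinearMap.comp_assoc, ← LinearMap.comp_assoc i, hcomp, LinearMap.id_comp, hpi]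

/-- A homomorphism from a finitely generated module to a direct sum lands in a finite subsum. -/
theorem exists_finset_support_subset {A : Type*} [AddCommGroup A] [Module R A] [Module.Finite R A]
    {B : Type*} [AddCommGroup B] [Module R B] {I : Type*} (h : A →ₗ[R] (I →₀ B)) :
    ∃ s : Finset I, ∀ x, (h x).support ⊆ s := by
  classical
  obtain ⟨n, G, hG⟩ := Module.Finite.exists_fin' R A
  refine ⟨Finset.univ.biUnion fun c : Fin n => (h (G (Pi.single c 1))).support, fun x a ha => ?_⟩
  by_contra hmem
  have h0 : ((Finsupp.lapply a).comp h).comp G = 0 := by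
    refine (Pi.basisFun R (Fin n)).ext fun c => ?_
    have := fun h => hmem (Finset.mem_biUnion.2 ⟨c, Finset.mem_univ c, h⟩)
    simpa using this
  obtain ⟨v, rfl⟩ := hG x
  exact Finsupp.mem_support_iff.1 ha (LinearMap.congr_fun h0 v)

end LocallyAdd


/-! ### The dual description of the flat dimension -/

section CharacterDimension

variable {S : Type u} [Ring S]

/-- The character module of a left `S`-module, as an object of the category of right
`S`-modules. -/
abbrev characterObj (F : ModuleCat.{u} S) : ModuleCat.{u} Sᵐᵒᵖ :=
  ModuleCat.of Sᵐᵒᵖ (CharacterModule F)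

/-- The homomorphism of character modules induced by `f`. -/
def characterMap {A B : ModuleCat.{u} S} (f : A →ₗ[S] B) :
    characterObj B →ₗ[Sᵐᵒᵖ] characterObj A where
  toFun φ := AddMonoidHom.comp φ f.toAddMonoidHom
  map_add' _ _ := rfl
  map_smul' c φ := CharacterModule.ext _ fun x => congrArg φ (map_smul f c.unop x).symm

theorem characterMap_apply {A B : ModuleCat.{u} S} (f : A →ₗ[S] B) (φ : CharacterModule B)
    (x : A) : (characterMap f φ : CharacterModule A) x = φ (f x) := rfl

variable {A B C : ModuleCat.{u} S} {f : A →ₗ[S] B} {g : B →ₗ[S] C}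

theorem characterMap_injective (hg : Function.Surjective g) :
    Function.Injective (characterMap g) := fun φ ψ h => CharacterModule.ext _ fun y => by
  obtain ⟨x, rfl⟩ := hg y
  exact congrArg (fun χ : CharacterModule B => χ x) h

theorem characterMap_surjective (hf : Function.Injective f) :
    Function.Surjective (characterMap f) := fun φ => by
  obtain ⟨ψ, hψ⟩ := exists_addMonoidHom_comp_eq f.toAddMonoidHom φ fun a ha => by
    rw [(injective_iff_map_eq_zero f).1 hf a ha]
    exact map_zero φ
  exact ⟨ψ, CharacterModule.ext _ hψ⟩

theorem characterMap_exact (hfg : Function.Exact f g) :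
    Function.Exact (characterMap g) (characterMap f) := fun φ => by
  constructor
  · intro h
    obtain ⟨ψ, hψ⟩ := exists_addMonoidHom_comp_eq g.toAddMonoidHom φ fun b hb => by
      obtain ⟨a, rfl⟩ := (hfg b).1 hb
      exact congrArg (fun χ : CharacterModule A => χ a) h
    exact ⟨ψ, CharacterModule.ext _ hψ⟩
  · rintro ⟨ψ, rfl⟩
    refine CharacterModule.ext _ fun a => ?_
    rw [characterMap_apply, characterMap_apply, hfg.apply_apply_eq_zero]
    exact map_zero _

theorem isFlat_iff_injective_characterObj (F : ModuleCat.{u} S) :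
    IsFlat F ↔ Injective (characterObj F) :=
  (isFlat_iff_injective_character F).trans (injective_module_iff (characterObj F))

/-- Dualizing a flat resolution gives an injective coresolution. The resulting bound no longer
depends on the chosen resolution, so it can be applied to the syzygies of another one. -/
theorem HasResolutionOfLength.hasInjectiveDimensionLE_characterObj {m : ℕ}
    (h : HasResolutionOfLength IsFlat A m) : HasInjectiveDimensionLE (characterObj A) m := by
  induction m generalizing A with
  | zero =>
    obtain ⟨T, hT, ⟨e⟩⟩ := h.exists_equiv
    refine injective_iff_hasInjectiveDimensionLT_one.1 ((injective_module_iff _).1 ?_)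
    have hT' := ((isFlat_iff_injective_character T).1 hT)
    exact Module.Baer.injective (Module.Baer.of_equiv (LinearEquiv.ofBijective
      (characterMap e.symm.toLinearMap) ⟨characterMap_injective e.symm.surjective,
        characterMap_surjective e.symm.injective⟩) (Module.Baer.of_injective hT'))
  | succ m ih =>
    obtain ⟨K, T, f, g, hf, hfg, hg, hT, hK⟩ := h.exists_shortExact
    exact ((shortExact_of (characterMap_injective hg) (characterMap_exact hfg)
      (characterMap_surjective hf)).hasInjectiveDimensionLT_X₃_iff m
        ((isFlat_iff_injective_characterObj T).1 hT)).1 (ih hK)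

theorem hasInjectiveDimensionLE_characterObj_of_succ (hf : Function.Injective f)
    (hfg : Function.Exact f g) (hg : Function.Surjective g) (hB : IsFlat B) {m : ℕ}
    (h : HasInjectiveDimensionLE (characterObj C) (m + 1)) :
    HasInjectiveDimensionLE (characterObj A) m :=
  ((shortExact_of (characterMap_injective hg) (characterMap_exact hfg)
    (characterMap_surjective hf)).hasInjectiveDimensionLT_X₃_iff m
      ((isFlat_iff_injective_characterObj B).1 hB)).2 h

theorem isFlat_of_hasInjectiveDimensionLE_zero
    (h : HasInjectiveDimensionLE (characterObj A) 0) : IsFlat A :=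
  (isFlat_iff_injective_characterObj A).2 (injective_iff_hasInjectiveDimensionLT_one.2 h)

end CharacterDimension

/-! ### The functor `Hom_R(U, -)` -/

section Star

variable {R : Type u} [Ring R] (U : ModuleCat.{u} R)

local instance : Semiring (EndRing U) := Ring.toSemiring

local instance : NonAssocSemiring (EndRing U) := Semiring.toNonAssocSemiring

/-- The map `Hom_R(U, A) → Hom_R(U, B)` induced by `g : A → B`. -/
def starMap {A B : ModuleCat.{u} R} (g : A →ₗ[R] B) :
    starModule U A →ₗ[EndRing U] starModule U B where
  toFun (φ : U →ₗ[R] A) := g.comp φ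
  map_add' φ ψ := LinearMap.comp_add (φ : U →ₗ[R] A) (ψ : U →ₗ[R] A) g
  map_smul' _ _ := rfl

variable {U} {A B C : ModuleCat.{u} R} {f : A →ₗ[R] B} {g : B →ₗ[R] C}

theorem starMap_injective (hf : Function.Injective f) : Function.Injective (starMap U f) :=
  fun _ _ h => LinearMap.ext fun u => hf (LinearMap.congr_fun h u)

theorem starMap_exact (hf : Function.Injective f) (hfg : Function.Exact f g) :
    Function.Exact (starMap U f) (starMap U g) := fun (φ : U →ₗ[R] B) => by
  constructor
  · intro (h : g.comp φ = 0)
    choose ψ hψ using fun u => (hfg (φ u)).1 (LinearMap.congr_fun h u)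
    let ψ' : U →ₗ[R] A :=
      { toFun := ψ
        map_add' := fun u v => hf (by simp only [map_add, hψ])
        map_smul' := fun r u => hf (by simp only [map_smul, hψ, RingHom.id_apply]) }
    exact ⟨ψ', LinearMap.ext hψ⟩
  · rintro ⟨(ψ : U →ₗ[R] A), rfl⟩
    exact LinearMap.ext fun u => hfg.apply_apply_eq_zero (ψ u)

/-- The isomorphism `Hom_R(U, A) ≃ Hom_R(U, B)` induced by an isomorphism `A ≃ B`. -/
def starEquiv (e : A ≃ₗ[R] B) : starModule U A ≃ₗ[EndRing U] starModule U B :=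
  LinearEquiv.ofBijective (starMap U e.toLinearMap) ⟨starMap_injective e.injective,
    fun (φ : U →ₗ[R] B) => ⟨e.symm.toLinearMap.comp φ, LinearMap.ext fun u =>
      e.apply_symm_apply (φ u)⟩⟩

theorem ext_subsingleton_of_isSummand (h : IsSummand (R := R) A B) {i : ℕ}
    (hB : Subsingleton (Abelian.Ext.{u} U B i)) : Subsingleton (Abelian.Ext.{u} U A i) := by
  obtain ⟨j, p, hpj⟩ := h
  refine subsingleton_of_forall_eq 0 fun x => ?_
  have : ModuleCat.ofHom j ≫ ModuleCat.ofHom p = 𝟙 A := ModuleCat.hom_ext hpj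
  rw [← x.comp_mk₀_id, ← this, ← Abelian.Ext.mk₀_comp_mk₀,
    ← Abelian.Ext.comp_assoc _ _ _ (add_zero i) (add_zero 0) (by omega),
    hB.elim (x.comp (Abelian.Ext.mk₀ (ModuleCat.ofHom j)) (add_zero i)) 0,
    Abelian.Ext.zero_comp]

/-- `Hom_R(U, -)` preserves finite resolutions by modules `T` with `Ext^i(U, T) = 0` for
`i ≥ 1`. -/
theorem HasResolutionOfLength.star {X : ModuleCat.{u} R → Prop}
    {Y : ModuleCat.{u} (EndRing U) → Prop}
    (hX : ∀ T, X T → ∀ i, Subsingleton (Abelian.Ext.{u} U T (i + 1)))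
    (hXY : ∀ T, X T → Y (starModule U T)) {m : ℕ} (h : HasResolutionOfLength X A m) :
    HasResolutionOfLength Y (starModule U A) m ∧
      ∀ i, Subsingleton (Abelian.Ext.{u} U A (i + 1)) := by
  -- The `Ext` vanishing is carried through the induction: `Ext^1(U, K) = 0` is what keeps `T → A`
  -- surjective under `Hom_R(U, -)`.
  induction m generalizing A with
  | zero =>
    obtain ⟨T, hT, ⟨e⟩⟩ := h.exists_equiv
    exact ⟨hasResolutionOfLength_zero (hXY T hT) (starEquiv e), fun i =>
      ext_subsingleton_of_isSummand ⟨e.symm.toLinearMap, e.toLinearMap, by ext; simp⟩ (hX T hT i)⟩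
  | succ m ih =>
    obtain ⟨K, T, f, g, hf, hfg, hg, hT, hK⟩ := h.exists_shortExact
    obtain ⟨hK1, hK2⟩ := ih hK
    refine ⟨hasResolutionOfLength_succ (starMap U f) (starMap U g) (starMap_injective hf)
      (starMap_exact hf hfg) ?_ (hXY T hT) hK1,
      fun i => ext_subsingleton_right₃ hf hfg hg (hX T hT i) (hK2 (i + 1))⟩
    have := hK2 0
    exact fun φ => exists_lift_of_ext_one hf hfg hg φ

/-- A relation `∑ s_i x_i = 0` says that `(x_i) : U^ι → T` kills the image of `σ = (s_i) : U → U^ι`.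
The induced map on the finitely generated cokernel of `σ` factors through some `U^κ`; the matrix of
`U^ι → U^κ` supplies the coefficients. -/
theorem LocallyAdd.eqFlat_star [Module.Finite R U] {T : ModuleCat.{u} R} (hT : LocallyAdd U T) :
    EqFlat (EndRing U) (starModule U T) := by
  classical
  intro ι _ s x hx
  let σ : U →ₗ[R] (ι → U) := LinearMap.pi fun i => DomMulAct.mk.symm (s i)
  let x' : ι → (U →ₗ[R] T) := x
  let F : (ι → U) →ₗ[R] T := LinearMap.lsum R (fun _ => U) ℕ x'
  have hx' : ∑ i, (x' i).comp (DomMulAct.mk.symm (s i) : U →ₗ[R] U) = 0 := hx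
  have hF : LinearMap.range σ ≤ LinearMap.ker F := by
    rintro _ ⟨u, rfl⟩
    have := LinearMap.congr_fun hx' u
    simpa [F, σ] using this
  obtain ⟨κ, _, β, y, hy⟩ := hT ((ι → U) ⧸ LinearMap.range σ) ((LinearMap.range σ).liftQ F hF)
  let α : (ι → U) →ₗ[R] (κ → U) := β.comp (LinearMap.range σ).mkQ
  have hα : ∀ w, α w = ∑ i, α (Pi.single i (w i)) := fun w => by
    rw [← map_sum, Finset.univ_sum_single]
  have hyα : ∀ w, y (α w) = F w := fun w => LinearMap.congr_fun hy (Submodule.Quotient.mk w)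
  have hασ : ∀ u, α (σ u) = 0 := fun u => by
    have : (LinearMap.range σ).mkQ (σ u) = 0 :=
      (Submodule.Quotient.mk_eq_zero _).2 (LinearMap.mem_range_self σ u)
    simp only [α, LinearMap.comp_apply, this, map_zero]
  let a : ι → κ → Module.End R U := fun i j =>
    (LinearMap.proj j).comp (α.comp (LinearMap.single R (fun _ => U) i))
  let y' : κ → (U →ₗ[R] T) := fun j => y.comp (LinearMap.single R (fun _ => U) j)
  refine ⟨κ, inferInstance, fun i j => DomMulAct.mk (a i j), y', fun i => ?_, fun j => ?_⟩
  · change x' i = ∑ j, (y' j).comp (a i j)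
    ext u
    have h1 : x' i u = F (Pi.single i u) := by simp only [F, LinearMap.lsum_piSingle]
    rw [h1, ← hyα, ← Finset.univ_sum_single (α (Pi.single i u)), map_sum, LinearMap.sum_apply]
    rfl
  -- Multiplication in `S` is reversed composition, so `s i` stands on the right in `Module.End R
  -- U`.
  · have : ∑ i, (a i j) * (DomMulAct.mk.symm (s i) : Module.End R U) = 0 := by
      ext u
      rw [LinearMap.sum_apply]
      have h2 := congrFun (hα (σ u)) j
      rw [hασ, Finset.sum_apply] at h2
      exact h2.symm
    let mk' : Module.End R U →+ EndRing U := ⟨⟨DomMulAct.mk, rfl⟩, fun _ _ => rfl⟩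
    have h3 := congrArg mk' this
    rw [map_sum, map_zero] at h3
    exact h3

/-- `Hom_R(U, -)` sends the modules in `Add U` to projective modules if `U` is finitely
generated. -/
theorem IsAdd.projective_star [Module.Finite R U] {T : ModuleCat.{u} R} (hT : IsAdd U T) :
    Module.Projective (EndRing U) (starModule U T) := by
  classical
  obtain ⟨I, i, p, hpi⟩ := hT
  -- Finite generation of `U` leaves only finitely many nonzero coordinates, so `φ ↦ (φ_a)` lands in
  -- the free module `S^(I)` and exhibits `Hom_R(U, T)` as its summand.
  have hfin : ∀ φ : U →ₗ[R] T, {a : I | DomMulAct.mk (M := Module.End R U)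
      ((Finsupp.lapply a).comp (i.comp φ)) ≠ 0}.Finite := by
    intro φ
    obtain ⟨t, ht⟩ := exists_finset_support_subset (i.comp φ)
    refine Set.Finite.subset t.finite_toSet fun a ha => ?_
    by_contra hmem
    refine ha (congrArg DomMulAct.mk (LinearMap.ext fun u => ?_ :
      (Finsupp.lapply a).comp (i.comp φ) = 0))
    exact Finsupp.notMem_support_iff.1 fun h => hmem (ht u h)
  let coord : starModule U T →ₗ[EndRing U] (I →₀ EndRing U) :=
    { toFun := fun φ : U →ₗ[R] T => Finsupp.ofSupportFinite _ (hfin φ)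
      map_add' := fun (φ ψ : U →ₗ[R] T) => Finsupp.ext fun a =>
        congrArg (DomMulAct.mk (M := Module.End R U)) (by
          rw [LinearMap.comp_add, LinearMap.comp_add] : (Finsupp.lapply a).comp (i.comp (φ + ψ)) =
            (Finsupp.lapply a).comp (i.comp φ) + (Finsupp.lapply a).comp (i.comp ψ))
      map_smul' := fun s (φ : U →ₗ[R] T) => Finsupp.ext fun a => rfl }
  let back : (I →₀ EndRing U) →ₗ[EndRing U] starModule U T :=
    Finsupp.linearCombination (EndRing U) fun a =>
      (p.comp (Finsupp.lsingle a) : U →ₗ[R] T)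
  refine Module.Projective.of_split coord back (LinearMap.ext fun (φ : U →ₗ[R] T) => ?_)
  have h1 : back (coord φ) = ∑ a ∈ (coord φ).support, (p.comp (Finsupp.lsingle a)).comp
      ((Finsupp.lapply a).comp (i.comp φ)) := rfl
  refine Eq.trans h1 (LinearMap.ext fun u => ?_)
  have h2 : (i (φ u)).support ⊆ (coord φ).support := by
    intro a ha
    rw [Finsupp.mem_support_iff] at ha ⊢
    intro h0
    exact ha (LinearMap.congr_fun (DomMulAct.mk.injective h0) u)
  rw [LinearMap.sum_apply]
  simp only [LinearMap.comp_apply, Finsupp.lapply_apply, Finsupp.lsingle_apply]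
  have h3 : ∑ a ∈ (coord φ).support, Finsupp.single a (i (φ u) a) = i (φ u) := by
    rw [← Finsupp.sum_of_support_subset (f := i (φ u)) h2 _ (by simp), Finsupp.sum_single]
  rw [← map_sum, h3]
  exact LinearMap.congr_fun hpi (φ u)

end Star


/-! ### Factorizations provided by flatness of `Hom_R(U, X)` -/

section Factor

variable {R : Type u} [Ring R] {U X : ModuleCat.{u} R}

/-- Equational flatness in terms of maps: `f σ = 0` is one relation among the components of `f`, and
the coefficients it yields form the matrix `α`. -/
theorem EqFlat.exists_factor (hX : EqFlat (EndRing U) (starModule U X)) {ι : Type} [Fintype ι]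
    (σ : U →ₗ[R] (ι → U)) (f : (ι → U) →ₗ[R] X) (hf : f.comp σ = 0) :
    ∃ (κ : Type) (_ : Fintype κ) (α : (ι → U) →ₗ[R] (κ → U)) (y : (κ → U) →ₗ[R] X),
      y.comp α = f ∧ α.comp σ = 0 := by
  classical
  let s : ι → Module.End R U := fun i => (LinearMap.proj i).comp σ
  let x : ι → (U →ₗ[R] X) := fun i => f.comp (LinearMap.single R (fun _ => U) i)
  have hsx : ∑ i, (x i).comp (s i) = 0 := by
    ext u
    have := LinearMap.congr_fun hf u
    rw [LinearMap.comp_apply, ← Finset.univ_sum_single (σ u), map_sum] at this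
    rw [LinearMap.sum_apply]
    exact this
  obtain ⟨κ, _, a, y, hx, ha⟩ := hX ι (fun i => DomMulAct.mk (s i)) x hsx
  let a' : ι → κ → Module.End R U := fun i j => DomMulAct.mk.symm (a i j)
  let y' : κ → (U →ₗ[R] X) := y
  have hx' : ∀ i, x i = ∑ j, (y' j).comp (a' i j) := hx
  have ha' : ∀ j, ∑ i, a' i j * s i = 0 := fun j => by
    let symm' : EndRing U →+ Module.End R U := ⟨⟨DomMulAct.mk.symm, rfl⟩, fun _ _ => rfl⟩
    have h := congrArg symm' (ha j)
    rw [map_sum, map_zero] at h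
    exact h
  refine ⟨κ, inferInstance, LinearMap.pi fun j => LinearMap.lsum R (fun _ => U) ℕ fun i => a' i j,
    LinearMap.lsum R (fun _ => U) ℕ y', ?_, ?_⟩
  · refine LinearMap.pi_ext fun i u => ?_
    have h1 : f (Pi.single i u) = x i u := rfl
    rw [h1, hx', LinearMap.sum_apply, LinearMap.comp_apply, LinearMap.lsum_apply,
      LinearMap.sum_apply]
    refine Finset.sum_congr rfl fun j _ => ?_
    simp only [LinearMap.comp_apply, LinearMap.proj_apply, LinearMap.pi_apply,
      LinearMap.lsum_piSingle]
  · ext u j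
    have := LinearMap.congr_fun (ha' j) u
    rw [LinearMap.sum_apply] at this
    simpa [s] using this

/-- The relations are killed one at a time; composing with further maps preserves those already
killed. -/
theorem EqFlat.exists_factor_finset (hX : EqFlat (EndRing U) (starModule U X)) {τ : Type}
    (t : Finset τ) {ι : Type} [Fintype ι] (σ : τ → U →ₗ[R] (ι → U)) (f : (ι → U) →ₗ[R] X)
    (hf : ∀ c ∈ t, f.comp (σ c) = 0) :
    ∃ (κ : Type) (_ : Fintype κ) (α : (ι → U) →ₗ[R] (κ → U)) (y : (κ → U) →ₗ[R] X),
      y.comp α = f ∧ ∀ c ∈ t, α.comp (σ c) = 0 := by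
  classical
  induction t using Finset.induction_on generalizing ι with
  | empty => exact ⟨ι, inferInstance, LinearMap.id, f, rfl, by simp⟩
  | insert c t _ ih =>
    obtain ⟨κ, _, α, y, hy, hα⟩ := hX.exists_factor (σ c) f (hf c (Finset.mem_insert_self c t))
    obtain ⟨κ', _, α', y', hy', hα'⟩ := ih (fun e => α.comp (σ e)) y fun e he => by
      rw [← LinearMap.comp_assoc, hy, hf e (Finset.mem_insert_of_mem he)]
    refine ⟨κ', inferInstance, α'.comp α, y', by rw [← LinearMap.comp_assoc, hy', hy], ?_⟩
    intro e he
    rcases Finset.mem_insert.1 he with rfl | he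
    · rw [LinearMap.comp_assoc, hα, LinearMap.comp_zero]
    · rw [LinearMap.comp_assoc, hα' e he]

theorem EqFlat.exists_factor_of_isSummand (hX : EqFlat (EndRing U) (starModule U X)) {τ : Type}
    [Fintype τ] {ι ι' : Type} [Fintype ι] [Fintype ι'] {A B : Type u} [AddCommGroup A] [Module R A]
    [AddCommGroup B] [Module R B] (hA : IsSummand (R := R) A (ι' → U))
    (hB : IsSummand (R := R) B (ι → U)) (σ : τ → A →ₗ[R] B) (f : B →ₗ[R] X)
    (hf : ∀ c, f.comp (σ c) = 0) :
    ∃ (κ : Type) (_ : Fintype κ) (α : B →ₗ[R] (κ → U)) (y : (κ → U) →ₗ[R] X),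
      y.comp α = f ∧ ∀ c, α.comp (σ c) = 0 := by
  classical
  obtain ⟨i, p, hpi⟩ := hB
  obtain ⟨i', p', hpi'⟩ := hA
  have hpi_apply : ∀ b, p (i b) = b := fun b => LinearMap.congr_fun hpi b
  obtain ⟨κ, _, α, y, hy, hα⟩ := hX.exists_factor_finset (τ := τ × ι') Finset.univ
    (fun c => i.comp ((σ c.1).comp (p'.comp (LinearMap.single R (fun _ => U) c.2)))) (f.comp p)
    fun c _ => by
      ext u
      simp only [LinearMap.comp_apply, hpi_apply]
      exact LinearMap.congr_fun (hf c.1) _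
  refine ⟨κ, inferInstance, α.comp i, y, ?_, fun c => ?_⟩
  · rw [← LinearMap.comp_assoc, hy, LinearMap.comp_assoc, hpi, LinearMap.comp_id]
  · have h0 : (α.comp (i.comp (σ c))).comp p' = 0 := by
      refine LinearMap.pi_ext fun e u => ?_
      exact LinearMap.congr_fun (hα (c, e) (Finset.mem_univ _)) u
    rw [LinearMap.comp_assoc, ← LinearMap.comp_id (α.comp (i.comp (σ c))), ← hpi',
      ← LinearMap.comp_assoc, h0, LinearMap.zero_comp]

theorem IsSummand.pi {A : Type u} [AddCommGroup A] [Module R A] {ι : Type}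
    (hA : IsSummand (R := R) A (ι → U)) (τ : Type) :
    IsSummand (R := R) (τ → A) (τ × ι → U) := by
  obtain ⟨i, p, hpi⟩ := hA
  refine ⟨LinearMap.pi fun c => (LinearMap.proj c.2).comp (i.comp (LinearMap.proj c.1)),
    LinearMap.pi fun c => p.comp (LinearMap.pi fun e => LinearMap.proj (c, e)), ?_⟩
  refine LinearMap.ext fun v => funext fun c => ?_
  exact LinearMap.congr_fun hpi (v c)

theorem IsSummand.prod {A B : Type u} [AddCommGroup A] [Module R A] [AddCommGroup B] [Module R B]
    {ι ι' : Type} (hA : IsSummand (R := R) A (ι → U)) (hB : IsSummand (R := R) B (ι' → U)) :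
    IsSummand (R := R) (A × B) (ι ⊕ ι' → U) := by
  obtain ⟨i, p, hpi⟩ := hA
  obtain ⟨i', p', hpi'⟩ := hB
  refine ⟨LinearMap.pi (Sum.elim (fun c => (LinearMap.proj c).comp (i.comp (LinearMap.fst R A B)))
      fun c => (LinearMap.proj c).comp (i'.comp (LinearMap.snd R A B))),
    (p.comp (LinearMap.pi fun c => LinearMap.proj (Sum.inl c))).prod
      (p'.comp (LinearMap.pi fun c => LinearMap.proj (Sum.inr c))), ?_⟩
  refine LinearMap.ext fun v => Prod.ext ?_ ?_
  · exact LinearMap.congr_fun hpi v.1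
  · exact LinearMap.congr_fun hpi' v.2

end Factor

/-! ### Modules that turn the coresolution of `R` into an exact sequence -/

section Coacyclic

variable {R : Type u} [Ring R]

/-- The functor `Hom_R(-, X)` is exact on the sequence `0 → R → W₀ → W₁ → ⋯`. -/
structure IsCoacyclic {W : ℕ → ModuleCat.{u} R} (η : R →ₗ[R] W 0) (d : ∀ i, W i →ₗ[R] W (i + 1))
    (X : ModuleCat.{u} R) : Prop where
  extend : ∀ x : R →ₗ[R] X, ∃ h : W 0 →ₗ[R] X, h.comp η = x
  factor_zero : ∀ h : W 0 →ₗ[R] X, h.comp η = 0 → ∃ h' : W 1 →ₗ[R] X, h'.comp (d 0) = h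
  factor_succ : ∀ i (h : W (i + 1) →ₗ[R] X), h.comp (d i) = 0 →
    ∃ h' : W (i + 1 + 1) →ₗ[R] X, h'.comp (d (i + 1)) = h

/-- An extension `h : V₁ → T` of `f x` need not land in `K`, but `π h` kills `δ₀`, so `π h = h' δ₁`.
Lifting `h'` to `h'' : V₂ → T`, the difference `h - h'' δ₁` lands in `K` and still extends `x`,
because `δ₁ δ₀ = 0`. -/
theorem exists_extension_to_kernel {V₀ V₁ V₂ K T X : Type*} [AddCommGroup V₀] [Module R V₀]
    [AddCommGroup V₁] [Module R V₁] [AddCommGroup V₂] [Module R V₂] [AddCommGroup K] [Module R K]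
    [AddCommGroup T] [Module R T] [AddCommGroup X] [Module R X] (δ₀ : V₀ →ₗ[R] V₁)
    (δ₁ : V₁ →ₗ[R] V₂) (hδ : δ₁.comp δ₀ = 0) (π : T →ₗ[R] X) (f : K →ₗ[R] T)
    (hf : Function.Injective f) (hfπ : Function.Exact f π)
    (hX : ∀ h : V₁ →ₗ[R] X, h.comp δ₀ = 0 → ∃ h' : V₂ →ₗ[R] X, h'.comp δ₁ = h)
    (hlift : ∀ h : V₂ →ₗ[R] X, ∃ h' : V₂ →ₗ[R] T, π.comp h' = h)
    (x : V₀ →ₗ[R] K) (hx : ∃ h : V₁ →ₗ[R] T, h.comp δ₀ = f.comp x) :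
    ∃ h : V₁ →ₗ[R] K, h.comp δ₀ = x := by
  obtain ⟨h, hh⟩ := hx
  have h0 : (π.comp h).comp δ₀ = 0 := by
    rw [LinearMap.comp_assoc, hh, ← LinearMap.comp_assoc, hfπ.linearMap_comp_eq_zero,
      LinearMap.zero_comp]
  obtain ⟨h', hh'⟩ := hX _ h0
  obtain ⟨h'', rfl⟩ := hlift h'
  have hmem : ∀ v, π ((h - h''.comp δ₁) v) = 0 := fun v => by
    have := LinearMap.congr_fun hh' v
    simp only [LinearMap.comp_apply] at this
    simp [this]
  choose k hk using fun v => (hfπ _).1 (hmem v)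
  refine ⟨⟨⟨k, fun v w => hf ?_⟩, fun r v => hf ?_⟩, LinearMap.ext fun v => hf ?_⟩
  · simp only [map_add, hk]
  · simp only [map_smul, hk, RingHom.id_apply]
  · refine (hk (δ₀ v)).trans ?_
    have h1 := LinearMap.congr_fun hh v
    have h2 := LinearMap.congr_fun hδ v
    simp only [LinearMap.comp_apply, LinearMap.zero_apply] at h1 h2
    simp [h1, h2]

theorem exists_lift_of_isSummand {U A : ModuleCat.{u} R} {T X : Type*} [AddCommGroup T]
    [Module R T] [AddCommGroup X] [Module R X] {π : T →ₗ[R] X}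
    (hlift : ∀ h : U →ₗ[R] X, ∃ h' : U →ₗ[R] T, π.comp h' = h) (hA : IsAddFin U A)
    (h : A →ₗ[R] X) : ∃ h' : A →ₗ[R] T, π.comp h' = h := by
  classical
  obtain ⟨k, i, p, hpi⟩ := hA
  choose ψ hψ using fun c : Fin k => hlift (h.comp (p.comp (LinearMap.single R (fun _ => U) c)))
  have h0 : π.comp (LinearMap.lsum R (fun _ => U) ℕ ψ) = h.comp p := by
    refine LinearMap.pi_ext fun c u => ?_
    rw [LinearMap.comp_apply, LinearMap.lsum_piSingle]
    exact LinearMap.congr_fun (hψ c) u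
  refine ⟨(LinearMap.lsum R (fun _ => U) ℕ ψ).comp i, ?_⟩
  rw [← LinearMap.comp_assoc, h0, LinearMap.comp_assoc, hpi, LinearMap.comp_id]

theorem IsAddFin.finite {U A : ModuleCat.{u} R} [Module.Finite R U] (hA : IsAddFin U A) :
    Module.Finite R A := by
  obtain ⟨k, i, p, hpi⟩ := hA
  exact Module.Finite.of_surjective p fun a => ⟨i a, LinearMap.congr_fun hpi a⟩

variable {W : ℕ → ModuleCat.{u} R} {η : R →ₗ[R] W 0} {d : ∀ i, W i →ₗ[R] W (i + 1)}
  {U : ModuleCat.{u} R}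

theorem IsCoacyclic.of_exact {K T X : ModuleCat.{u} R} (hT : IsCoacyclic η d T)
    (hX : IsCoacyclic η d X) (hW : ∀ i, IsAddFin U (W i)) (hη : (d 0).comp η = 0)
    (hd : ∀ i, (d (i + 1)).comp (d i) = 0) {f : K →ₗ[R] T} {π : T →ₗ[R] X}
    (hf : Function.Injective f) (hfπ : Function.Exact f π)
    (hlift : ∀ h : U →ₗ[R] X, ∃ h' : U →ₗ[R] T, π.comp h' = h) : IsCoacyclic η d K where
  extend x := exists_extension_to_kernel η (d 0) hη π f hf hfπ hX.factor_zero
    (exists_lift_of_isSummand hlift (hW 1)) x (hT.extend _)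
  factor_zero h hh := exists_extension_to_kernel (d 0) (d 1) (hd 0) π f hf hfπ (hX.factor_succ 0)
    (exists_lift_of_isSummand hlift (hW 2)) h (hT.factor_zero _ (by
      rw [LinearMap.comp_assoc, hh, LinearMap.comp_zero]))
  factor_succ i h hh := exists_extension_to_kernel (d (i + 1)) (d (i + 2)) (hd (i + 1)) π f hf hfπ
    (hX.factor_succ (i + 1)) (exists_lift_of_isSummand hlift (hW (i + 3))) h (hT.factor_succ i _ (by
      rw [LinearMap.comp_assoc, hh, LinearMap.comp_zero]))

theorem IsCoacyclic.of_injective {E : ModuleCat.{u} R} (hE : Module.Injective R E)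
    (hη : Function.Injective η) (hηd : Function.Exact η (d 0))
    (hd : ∀ i, Function.Exact (d i) (d (i + 1))) : IsCoacyclic η d E where
  extend x := exists_comp_eq_of_baer (Module.Baer.of_injective hE) η x (by
    rw [LinearMap.ker_eq_bot.2 hη]; exact bot_le)
  factor_zero h hh := exists_comp_eq_of_baer (Module.Baer.of_injective hE) (d 0) h (by
    intro w hw
    obtain ⟨r, rfl⟩ := (hηd w).1 hw
    exact LinearMap.congr_fun hh r)
  factor_succ i h hh := exists_comp_eq_of_baer (Module.Baer.of_injective hE) (d (i + 1)) h (by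
    intro w hw
    obtain ⟨r, rfl⟩ := (hd i w).1 hw
    exact LinearMap.congr_fun hh r)

/-- Finite generation of `A` leaves finitely many relevant coordinates, so the coordinatewise
extensions give a map into the direct sum and not only into the product. -/
theorem exists_comp_eq_finsupp {A B : Type*} [AddCommGroup A] [Module R A] [Module.Finite R A]
    [AddCommGroup B] [Module R B] {I : Type*} (δ : A →ₗ[R] B) (h : A →ₗ[R] (I →₀ U))
    (hh : ∀ a, ∃ h' : B →ₗ[R] U, h'.comp δ = (Finsupp.lapply a).comp h) :
    ∃ h' : B →ₗ[R] (I →₀ U), h'.comp δ = h := by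
  obtain ⟨s, hs⟩ := exists_finset_support_subset h
  choose k hk using hh
  refine ⟨∑ a ∈ s, (Finsupp.lsingle a).comp (k a), LinearMap.ext fun x => ?_⟩
  have : ∀ a, k a (δ x) = h x a := fun a => LinearMap.congr_fun (hk a) x
  simp only [LinearMap.comp_apply, LinearMap.sum_apply, this, Finsupp.lsingle_apply]
  rw [← Finsupp.sum_of_support_subset (f := h x) (hs x) _ (by simp), Finsupp.sum_single]

theorem IsCoacyclic.finsupp [Module.Finite R U] (hW : ∀ i, IsAddFin U (W i))
    (hU : IsCoacyclic η d U) (I : Type u) : IsCoacyclic η d (ModuleCat.of R (I →₀ U)) where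
  extend x := exists_comp_eq_finsupp η x fun _ => hU.extend _
  factor_zero h hh :=
    have := (hW 0).finite
    exists_comp_eq_finsupp (d 0) h fun a => hU.factor_zero _ (by
      rw [LinearMap.comp_assoc, hh, LinearMap.comp_zero])
  factor_succ i h hh :=
    have := (hW (i + 1)).finite
    exists_comp_eq_finsupp (d (i + 1)) h fun a => hU.factor_succ i _ (by
      rw [LinearMap.comp_assoc, hh, LinearMap.comp_zero])

theorem IsCoacyclic.exists_extend_of_isSummand (hU : IsCoacyclic η d U) {A : Type u}
    [AddCommGroup A] [Module R A] {ι : Type} (hA : IsSummand (R := R) A (ι → U)) (x : R →ₗ[R] A) :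
    ∃ h : W 0 →ₗ[R] A, h.comp η = x := by
  obtain ⟨i, p, hpi⟩ := hA
  choose k hk using fun c : ι => hU.extend ((LinearMap.proj c).comp (i.comp x))
  have h0 : (LinearMap.pi k).comp η = i.comp x := by
    refine LinearMap.ext fun r => funext fun c => ?_
    exact LinearMap.congr_fun (hk c) r
  exact ⟨p.comp (LinearMap.pi k), by
    rw [LinearMap.comp_assoc, h0, ← LinearMap.comp_assoc, hpi, LinearMap.id_comp]⟩

/-- Present `M` by `R^b → R^a`. The map `R^a → X` extends to `H : W_0^a → X`, and each relation `r_c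
: R → R^a` to `ρ_c : W_0 → W_0^a`. The composite `H ρ_c` vanishes only on `R`, so it equals `k_c
d_0` for some `k_c : W_1 → X`. Thus `(H, -K)` on `W_0^a × W_1^b` kills the maps `(ρ_c, d_0)`, and
flatness factors it through a power of `U` in which they still vanish. At `η(1)` the correction
disappears since `d_0 η = 0`, so the restriction to `R^a` kills the relations and descends to `M`.
-/
theorem IsCoacyclic.locallyAdd [IsNoetherianRing R] {X : ModuleCat.{u} R}
    (hX : IsCoacyclic η d X) (hU : IsCoacyclic η d U) (hW : ∀ i, IsAddFin U (W i))
    (hη : (d 0).comp η = 0) (hflat : EqFlat (EndRing U) (starModule U X)) : LocallyAdd U X := by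
  classical
  intro M _ _ _ g
  obtain ⟨a, π, hπ⟩ := Module.Finite.exists_fin' R M
  obtain ⟨b, γ, hγ⟩ := Module.Finite.exists_fin' R (LinearMap.ker π)
  obtain ⟨k₀, hk₀⟩ := hW 0
  obtain ⟨k₁, hk₁⟩ := hW 1
  let r : Fin b → (Fin a → R) := fun c => γ (Pi.single c 1)
  have hr : ∀ c, π (r c) = 0 := fun c => (γ (Pi.single c 1)).2
  choose h hh using fun e : Fin a =>
    hX.extend (LinearMap.toSpanSingleton R X (g (π (Pi.single e 1))))
  let H : (Fin a → W 0) →ₗ[R] X := LinearMap.lsum R (fun _ => W 0) ℕ h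
  let ηa : (Fin a → R) →ₗ[R] (Fin a → W 0) := LinearMap.pi fun e => η.comp (LinearMap.proj e)
  have hηa : ∀ e, ηa (Pi.single e 1) = Pi.single e (η 1) := fun e => by
    ext e'
    by_cases he : e' = e
    · subst he; simp [ηa]
    · simp [ηa, he]
  have hH : H.comp ηa = g.comp π := by
    refine (Pi.basisFun R (Fin a)).ext fun e => ?_
    rw [Pi.basisFun_apply, LinearMap.comp_apply, hηa, LinearMap.lsum_piSingle]
    simpa using LinearMap.congr_fun (hh e) 1
  have hsum₀ := IsSummand.pi hk₀ (Fin a)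
  choose ρ hρ using fun c : Fin b =>
    hU.exists_extend_of_isSummand hsum₀ (LinearMap.toSpanSingleton R _ (ηa (r c)))
  have hρ1 : ∀ c, ρ c (η 1) = ηa (r c) := fun c => by
    simpa using LinearMap.congr_fun (hρ c) 1
  choose k hk using fun c : Fin b => hX.factor_zero (H.comp (ρ c)) (LinearMap.ext_ring (by
    rw [LinearMap.comp_apply, LinearMap.comp_apply, hρ1, ← LinearMap.comp_apply, hH,
      LinearMap.comp_apply, hr, map_zero, LinearMap.zero_apply]))
  let K : (Fin b → W 1) →ₗ[R] X := LinearMap.lsum R (fun _ => W 1) ℕ k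
  obtain ⟨κ, _, α, y, hy, hα⟩ := hflat.exists_factor_of_isSummand hk₀
    (hsum₀.prod (IsSummand.pi hk₁ (Fin b)))
    (fun c => (ρ c).prod ((LinearMap.single R (fun _ => W 1) c).comp (d 0)))
    (H.coprod (-K)) fun c => by
      refine LinearMap.ext fun w => ?_
      have h1 : k c (d 0 w) = H (ρ c w) := LinearMap.congr_fun (hk c) w
      have h2 : K (Pi.single c (d 0 w)) = k c (d 0 w) := by
        simp only [K, LinearMap.lsum_piSingle]
      change H (ρ c w) + -K (Pi.single c (d 0 w)) = 0
      rw [h2, h1, add_neg_cancel]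
  let β₀ : (Fin a → R) →ₗ[R] (κ → U) := (α.comp (LinearMap.inl R _ _)).comp ηa
  have hβ₀ : LinearMap.ker π ≤ LinearMap.ker β₀ := by
    intro v hv
    obtain ⟨w, hw⟩ := hγ ⟨v, hv⟩
    have h0 : β₀.comp ((LinearMap.ker π).subtype.comp γ) = 0 := by
      refine (Pi.basisFun R (Fin b)).ext fun c => ?_
      have h1 := LinearMap.congr_fun (hα c) (η 1)
      have h2 : d 0 (η 1) = 0 := LinearMap.congr_fun hη 1
      change α (ρ c (η 1), Pi.single c (d 0 (η 1))) = 0 at h1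
      rw [hρ1, h2, Pi.single_zero] at h1
      rw [Pi.basisFun_apply]
      exact h1
    have := LinearMap.congr_fun h0 w
    simpa [hw] using this
  obtain ⟨β, hβ⟩ := exists_comp_eq_of_surjective hπ β₀ hβ₀
  refine ⟨κ, inferInstance, β, y, LinearMap.ext fun m => ?_⟩
  obtain ⟨v, rfl⟩ := hπ m
  have h1 : β (π v) = α (ηa v, 0) := LinearMap.congr_fun hβ v
  have h2 : y (α (ηa v, 0)) = H (ηa v) := by
    simpa using LinearMap.congr_fun hy (ηa v, 0)
  rw [LinearMap.comp_apply, h1, h2]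
  exact LinearMap.congr_fun hH v

end Coacyclic


/-! ### The resolution of an injective module by direct sums of copies of `U` -/

section Syzygy

variable {R : Type u} [Ring R] (U : ModuleCat.{u} R)

/-- The direct sum of copies of `U` indexed by `Hom_R(U, X)`. -/
abbrev precover (X : ModuleCat.{u} R) : ModuleCat.{u} R :=
  ModuleCat.of R ((U →ₗ[R] X) →₀ U)

/-- The evaluation map `U^(Hom_R(U, X)) → X`. -/
def precoverMap (X : ModuleCat.{u} R) : precover U X →ₗ[R] X :=
  Finsupp.lsum ℕ fun φ => φ

theorem exists_lift_precoverMap {X : ModuleCat.{u} R} (φ : U →ₗ[R] X) :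
    ∃ φ' : U →ₗ[R] precover U X, (precoverMap U X).comp φ' = φ :=
  ⟨Finsupp.lsingle φ, LinearMap.ext fun u => by simp [precoverMap]⟩

theorem isAdd_precover (X : ModuleCat.{u} R) : IsAdd U (precover U X) :=
  ⟨_, LinearMap.id, LinearMap.id, rfl⟩

/-- The iterated kernels of the evaluation maps, starting with `E`. -/
def syzygy (E : ModuleCat.{u} R) : ℕ → ModuleCat.{u} R
  | 0 => E
  | j + 1 => ModuleCat.of R (LinearMap.ker (precoverMap U (syzygy E j)))

variable {U} {E : ModuleCat.{u} R}

/-- The inclusion of a syzygy into the preceding direct sum of copies of `U`. -/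
def syzygyIncl (E : ModuleCat.{u} R) (j : ℕ) :
    syzygy U E (j + 1) →ₗ[R] precover U (syzygy U E j) :=
  (LinearMap.ker (precoverMap U (syzygy U E j))).subtype

theorem syzygyIncl_injective (j : ℕ) : Function.Injective (syzygyIncl (U := U) E j) :=
  Subtype.val_injective

theorem syzygy_exact (j : ℕ) :
    Function.Exact (syzygyIncl E j) (precoverMap U (syzygy U E j)) :=
  LinearMap.exact_subtype_ker_map _

variable {W : ℕ → ModuleCat.{u} R} {η : R →ₗ[R] W 0} {d : ∀ i, W i →ₗ[R] W (i + 1)}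

/-- An element of `X` is a map `R → X`; it extends to `W_0`, which is in `add U`, and from there
lifts to the direct sum of copies of `U`. -/
theorem IsCoacyclic.precoverMap_surjective {X : ModuleCat.{u} R} (hX : IsCoacyclic η d X)
    (hW : IsAddFin U (W 0)) : Function.Surjective (precoverMap U X) := fun x => by
  obtain ⟨h, hh⟩ := hX.extend (LinearMap.toSpanSingleton R X x)
  obtain ⟨h', rfl⟩ := exists_lift_of_isSummand (exists_lift_precoverMap U) hW h
  exact ⟨h' (η 1), by simpa using LinearMap.congr_fun hh 1⟩

theorem IsCoacyclic.syzygy [Module.Finite R U] (hE : IsCoacyclic η d E) (hU : IsCoacyclic η d U)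
    (hW : ∀ i, IsAddFin U (W i)) (hη : (d 0).comp η = 0) (hd : ∀ i, (d (i + 1)).comp (d i) = 0)
    (j : ℕ) : IsCoacyclic η d (syzygy U E j) := by
  induction j with
  | zero => exact hE
  | succ j ih =>
    exact (hU.finsupp hW _).of_exact ih hW hη hd (syzygyIncl_injective j) (syzygy_exact j)
      (exists_lift_precoverMap U)

theorem isFlat_starModule [IsNoetherianRing R] [Module.Finite R U] {T : ModuleCat.{u} R}
    (hT : IsAddLim U T) : IsFlat (starModule U T) :=
  (isFlat_iff_eqFlat _).2 hT.locallyAdd.eqFlat_star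

/-- Each syzygy lowers the bound by one, because `Hom_R(U, -)` of the direct sum of copies of `U` is
flat. -/
theorem hasInjectiveDimensionLE_characterObj_syzygy [IsNoetherianRing R] [Module.Finite R U]
    {m k : ℕ} (j : ℕ) (h : HasInjectiveDimensionLE (characterObj (starModule U E)) m)
    (hk : k + j = m) :
    HasInjectiveDimensionLE (characterObj (starModule U (syzygy U E j))) k := by
  induction j generalizing k with
  | zero =>
    obtain rfl : k = m := hk
    exact h
  | succ j ih =>
    exact hasInjectiveDimensionLE_characterObj_of_succ (starMap_injective (syzygyIncl_injective j))
      (starMap_exact (syzygyIncl_injective j) (syzygy_exact j))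
      (fun φ => exists_lift_precoverMap U φ) (isFlat_starModule (isAdd_precover U _).isAddLim)
      (ih (by omega))

/-- Dimension shifting along the syzygies of `E`. -/
theorem ext_syzygy_subsingleton {X : ModuleCat.{u} R}
    (hX : ∀ i, Subsingleton (Abelian.Ext.{u} U X (i + 1)))
    (hsurj : ∀ j, Function.Surjective (precoverMap U (syzygy U E j))) (j i : ℕ)
    (h : Subsingleton (Abelian.Ext.{u} E X (i + 1 + j))) :
    Subsingleton (Abelian.Ext.{u} (syzygy U E j) X (i + 1)) := by
  induction j generalizing i with
  | zero => exact h
  | succ j ih =>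
    refine ext_subsingleton_left₁ (syzygyIncl_injective j) (syzygy_exact j) (hsurj j)
      (ext_finsupp_subsingleton U _ i X (hX i)) (ih (i + 1) ?_)
    rwa [show i + 1 + 1 + j = i + 1 + (j + 1) by omega]

/-- The next syzygy has injective dimension at most `n ≤ j`, so `Ext^{j+1}(E, -)` vanishes on it.
Shifting yields `Ext^1(X_j, X_{j+1}) = 0`, and the sequence defining `X_{j+1}` splits. -/
theorem isAdd_syzygy_of_succ [IsNoetherianRing R] [Module.Finite R U] {n : ℕ}
    (hU : HasInjectiveDimensionLE U n) (hext : ∀ i, Subsingleton (Abelian.Ext.{u} U U (i + 1)))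
    (hsurj : ∀ j, Function.Surjective (precoverMap U (syzygy U E j))) {j : ℕ} (hj : n ≤ j)
    (h : LocallyAdd U (syzygy U E (j + 1))) : IsAdd U (syzygy U E j) := by
  have hid := h.hasInjectiveDimensionLE hU
  have hE : Subsingleton (Abelian.Ext.{u} E (syzygy U E (j + 1)) (0 + 1 + j)) :=
    HasInjectiveDimensionLT.subsingleton _ (n + 1) _ (by omega) _
  have := ext_syzygy_subsingleton (fun i => h.ext_subsingleton i U (hext i)) hsurj j 0 hE
  obtain ⟨s, hs⟩ := exists_lift_of_ext_one (syzygyIncl_injective j) (syzygy_exact j) (hsurj j)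
    (X := syzygy U E j) LinearMap.id
  exact ⟨_, s, precoverMap U _, hs⟩

theorem isAdd_syzygy [IsNoetherianRing R] [Module.Finite R U] {n : ℕ}
    (hU : HasInjectiveDimensionLE U n) (hext : ∀ i, Subsingleton (Abelian.Ext.{u} U U (i + 1)))
    (hsurj : ∀ j, Function.Surjective (precoverMap U (syzygy U E j))) (k : ℕ)
    (h : LocallyAdd U (syzygy U E (n + k + 1))) : IsAdd U (syzygy U E n) := by
  induction k with
  | zero => exact isAdd_syzygy_of_succ hU hext hsurj le_rfl h
  | succ k ih =>
    exact ih (isAdd_syzygy_of_succ hU hext hsurj (by omega) h).isAddLim.locallyAdd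

theorem hasResolutionOfLength_syzygy
    (hsurj : ∀ j, Function.Surjective (precoverMap U (syzygy U E j))) {n : ℕ}
    (h : IsAdd U (syzygy U E n)) (i j : ℕ) (hij : j + i = n) :
    HasResolutionOfLength (IsAdd U) (syzygy U E j) i := by
  induction i generalizing j with
  | zero =>
    obtain rfl : j = n := hij
    exact hasResolutionOfLength_zero h (LinearEquiv.refl R _)
  | succ i ih =>
    exact hasResolutionOfLength_succ (syzygyIncl E j) (precoverMap U (syzygy U E j))
      (syzygyIncl_injective j) (syzygy_exact j) (hsurj j) (isAdd_precover U _)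
      (ih (j + 1) (by omega))

/-- If `Hom_R(U, E)` has finite flat dimension for an injective module `E`, then `E` has an
`Add U`-resolution whose length is the injective dimension of `U`. -/
theorem hasResolutionOfLength_isAdd_of_isFlat [IsNoetherianRing R] (hU : IsGeneralizedTilting U)
    (hE : Module.Injective R E) {n : ℕ} (hn : HasInjectiveDimensionLE U n) {m : ℕ}
    (h : HasResolutionOfLength IsFlat (starModule U E) m) :
    HasResolutionOfLength (IsAdd U) E n := by
  obtain ⟨⟨hfin, -⟩, hext, W, η, d, hW, ⟨hη, hηd, hd⟩, hη', hηd', hd'⟩ := hU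
  have hcU : IsCoacyclic η d U := ⟨hη', fun h hh => (hηd' h).1 hh, fun i h hh => (hd' i h).1 hh⟩
  have hcE : IsCoacyclic η d E := .of_injective hE hη hηd hd
  have hsyz := hcE.syzygy hcU hW hηd.linearMap_comp_eq_zero fun i => (hd i).linearMap_comp_eq_zero
  have hsurj := fun j => (hsyz j).precoverMap_surjective (hW 0)
  have hid := h.hasInjectiveDimensionLE_characterObj
  -- The index is at least `m`, for flatness, and of the form `n + k + 1`, where the descent of
  -- `isAdd_syzygy` to `n` starts. The bound `m` is weakened to `n + m + 1` so that exactly `0`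
  -- remains.
  have hflat : IsFlat (starModule U (syzygy U E (n + m + 1))) :=
    isFlat_of_hasInjectiveDimensionLE_zero (hasInjectiveDimensionLE_characterObj_syzygy
      (m := n + m + 1) (n + m + 1) (hasInjectiveDimensionLT_of_ge _ (m + 1) _ (by omega))
      (by omega))
  have hloc := (hsyz (n + m + 1)).locallyAdd hcU hW hηd.linearMap_comp_eq_zero
    ((isFlat_iff_eqFlat _).1 hflat)
  exact hasResolutionOfLength_syzygy hsurj
    (isAdd_syzygy hn (fun i => hext (i + 1) (by omega)) hsurj m hloc) n 0 (by omega)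

end Syzygy

end WakamatsuTilting

end

open WakamatsuTilting in
theorem theorem2p11 {R : Type u} [Ring R] (hR : IsNoetherianRing R)
    (U : ModuleCat.{u} R) (hU : IsGeneralizedTilting U)
    (hS : IsNoetherianRing (EndRing U)ᵐᵒᵖ)
    (E : ModuleCat.{u} R) (hE : Module.Injective R E)
    (n : ℕ) (hn : injDim U = n) :
    List.TFAE [
      flatDim (starModule U E) < ⊤,
      projDim (starModule U E) < ⊤,
      limDim U E < ⊤,
      addResolDim U E < ⊤,
      flatDim (starModule U E) ≤ n,
      projDim (starModule U E) ≤ n,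
      limDim U E ≤ n,
      addResolDim U E ≤ n] := by
  have hfin : Module.Finite R U := hU.1.1
  have hext : ∀ i, Subsingleton (Abelian.Ext.{u} U U (i + 1)) := fun i => hU.2.1 (i + 1) (by omega)
  have hid : HasInjectiveDimensionLE U n := (injDim_le_iff U n).1 hn.le
  have hflat : ∀ P : ModuleCat.{u} (EndRing U), Module.Projective (EndRing U) P → IsFlat P :=
    fun P hP => (isFlat_iff_eqFlat P).2 eqFlat_of_projective
  have hext_lim : ∀ T, IsAddLim U T → ∀ i, Subsingleton (Abelian.Ext.{u} U T (i + 1)) :=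
    fun T hT i => hT.locallyAdd.ext_subsingleton i U (hext i)
  simp only [flatDim, limDim, addResolDim, resolDim_lt_top_iff, resolDim_le_iff, projDim_le_iff,
    projDim_lt_top_iff]
  -- Statement 8 implies all the others, and each of them leads to 1 by weakening a bound, enlarging
  -- a class or applying `Hom_R(U, -)`. Injectivity of `E` and the value of `n` enter only in
  -- closing the circle from 1 to 8.
  tfae_have 8 → 4 := fun ⟨k, _, h⟩ => ⟨k, h⟩
  tfae_have 7 → 3 := fun ⟨k, _, h⟩ => ⟨k, h⟩
  tfae_have 6 → 2 := fun h => ⟨n, h⟩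
  tfae_have 5 → 1 := fun ⟨k, _, h⟩ => ⟨k, h⟩
  tfae_have 4 → 3 := fun ⟨k, h⟩ => ⟨k, h.mono fun _ => IsAdd.isAddLim⟩
  tfae_have 8 → 7 := fun ⟨k, hk, h⟩ => ⟨k, hk, h.mono fun _ => IsAdd.isAddLim⟩
  tfae_have 3 → 1 := fun ⟨k, h⟩ => ⟨k, (h.star hext_lim fun _ => isFlat_starModule).1⟩
  tfae_have 8 → 6 := fun ⟨k, hk, h⟩ => by
    have h' := (hasProjectiveDimensionLE_iff_hasResolutionOfLength _ k).2
      (h.star (fun T hT => hext_lim T hT.isAddLim) fun _ => IsAdd.projective_star).1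
    exact hasProjectiveDimensionLT_of_ge _ (k + 1) _ (by omega)
  tfae_have 6 → 5 := fun h => ⟨n, le_rfl,
    ((hasProjectiveDimensionLE_iff_hasResolutionOfLength _ n).1 h).mono hflat⟩
  tfae_have 2 → 1 := fun ⟨k, h⟩ => ⟨k,
    ((hasProjectiveDimensionLE_iff_hasResolutionOfLength _ k).1 h).mono hflat⟩
  tfae_have 1 → 8 := fun ⟨_, h⟩ =>
    ⟨n, le_rfl, hasResolutionOfLength_isAdd_of_isFlat hU hE hid h⟩
  tfae_finish
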